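/- **Setting.** Let $2\le k<n$. There are $n$ bidders with unit demand for $k$ identical items. Bidder $i$ privately observes a signal $s_i$; signals are i.i.d. with a density $f$ that is positive on an open interval $(0,\bar s)$, $0<\bar s\le\infty$, and vanishes outside it, and $\mathbb E[s_i^2]<\infty$. For a proportion $c\in[0,1]$ of common value, bidder $i$'s value for an item is $v_i(\mathbf s)=(1-c)s_i+\frac cn\sum_{j=1}^n s_j$. Write $Y_m(\mathbf x)$ for the $m$-th highest entry of a vector $\mathbf x$. In the $\delta$-mixed auction, $\delta\in[0,1]$, bidders submit nonnegative bids $b_i$; bidder $i$ wins an item if $b_i>Y_{k+1}(\mathbf b)$ and then pays $\delta b_i+(1-\delta)Y_{k+1}(\mathbf b)$, while losers pay nothing. The case $\delta=0$ is the uniform-price auction. Let $\beta^\delta$ be a symmetric Bayes–Nash equilibrium bidding strategy that is strictly increasing on $(0,\bar s)$, and let $u_i^\delta(\mathbf s)$ be bidder $i$'s ex-post utility (value of the item if won, minus payment) when all bidders follow $\beta^\delta$. Bidder $i$ is a winner at $\mathbf s$ if $s_i>Y_{k+1}(\mathbf s)$. We say that $\delta$-mixed pricing *dominates uniform pricing in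 pairwise differences* if, for almost every signal profile $\mathbf s$, $|u_i^\delta(\mathbf s)-u_j^\delta(\mathbf s)|\le|u_i^0(\mathbf s)-u_j^0(\mathbf s)|$ for all winners $i,j$, with strict inequality for at least one pair of winners. **Theorem.** Suppose that the signal density $f$ is log-concave, i.e. $\log f$ is concave on $(0,\bar s)$. Then for every $\delta$ with $0<\delta\le\min\{1,2(1-c)\}$ (in particular, for every strictly mixed pricing rule, $0<\delta<1$, with $\delta\le 2(1-c)$), $\delta$-mixed pricing dominates uniform pricing in pairwise differences. -/

import Mathlib

open MeasureTheory

noncomputable section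

namespace MixedAuction

/-- The open support `(0, sbar)` of the signals, as a set of reals; the upper limit `sbar` may be
finite or `+∞`. -/
def openSupport (sbar : EReal) : Set ℝ := {s : ℝ | 0 < s ∧ (s : EReal) < sbar}

/-- The probability law on `ℝ` with density `f`. -/
def signalLaw (f : ℝ → ℝ) : Measure ℝ :=
  volume.withDensity (fun s => ENNReal.ofReal (f s))

/-- The joint law of `n` independent signals, each with density `f`. -/
def profileLaw (n : ℕ) (f : ℝ → ℝ) : Measure (Fin n → ℝ) :=
  Measure.pi (fun _ => signalLaw f)

/-- `f` is an admissible signal density with open support `(0, sbar)`: it is positive there, it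
vanishes (almost everywhere) outside, it has total mass one, and signals have a finite second
moment. -/
structure IsSignalDensity (f : ℝ → ℝ) (sbar : EReal) : Prop where
  measurable : Measurable f
  pos : ∀ s ∈ openSupport sbar, 0 < f s
  ae_eq_zero : ∀ᵐ s : ℝ, s ∉ openSupport sbar → f s = 0
  lintegral_eq_one : ∫⁻ s, ENNReal.ofReal (f s) = 1
  second_moment : Integrable (fun s : ℝ => s ^ 2) (signalLaw f)

/-- Log-concavity of a function that is positive on `S`: its logarithm is concave on `S`. -/
def LogConcaveOn (S : Set ℝ) (f : ℝ → ℝ) : Prop :=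
  ConcaveOn ℝ S (fun s => Real.log (f s))

/-- `kthHighest m x` is the `m`-th highest entry of `x` (for `1 ≤ m ≤ n`, entries counted with
multiplicity): the largest `t` such that at least `m` entries are `≥ t`. -/
def kthHighest {n : ℕ} (m : ℕ) (x : Fin n → ℝ) : ℝ :=
  sSup {t : ℝ | m ≤ (Finset.univ.filter (fun j => t ≤ x j)).card}

/-- Bidder `i` wins one of the `k` items: their entry exceeds the `(k+1)`-th highest one.
Applied to bids, and to signals. -/
def Wins {n : ℕ} (k : ℕ) (x : Fin n → ℝ) (i : Fin n) : Prop :=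
  kthHighest (k + 1) x < x i

/-- Bidder `i`'s value for an item, with proportion `c` of common value. -/
def value {n : ℕ} (c : ℝ) (s : Fin n → ℝ) (i : Fin n) : ℝ :=
  (1 - c) * s i + c / n * ∑ j, s j

open scoped Classical in
/-- The payment of bidder `i` in the `k`-unit `δ`-mixed auction at the bids `b`. -/
def payment {n : ℕ} (k : ℕ) (δ : ℝ) (b : Fin n → ℝ) (i : Fin n) : ℝ :=
  if Wins k b i then δ * b i + (1 - δ) * kthHighest (k + 1) b else 0

open scoped Classical in
/-- Ex-post utility (surplus) of bidder `i` at signals `s` and bids `b`: the value of the item if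
one is won, minus the payment. -/
def surplus {n : ℕ} (c : ℝ) (k : ℕ) (δ : ℝ) (s b : Fin n → ℝ) (i : Fin n) : ℝ :=
  (if Wins k b i then value c s i else 0) - payment k δ b i

/-- Interim expected utility of bidder `i` with signal `x` who bids `b`, when all other bidders
follow the strategy `β`. The `i`-th coordinate of the integration variable is overwritten, so by
independence the expectation is over the opponents' signals. -/
def interimUtility (n : ℕ) (f : ℝ → ℝ) (c : ℝ) (k : ℕ) (δ : ℝ) (β : ℝ → ℝ)
    (i : Fin n) (x b : ℝ) : ℝ :=
  ∫ s, surplus c k δ (Function.update s i x) (Function.update (fun j => β (s j)) i b) i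
    ∂(profileLaw n f)

/-- `β` is a symmetric, increasing Bayes-Nash equilibrium bidding strategy of the `k`-unit
`δ`-mixed auction with `n` bidders; bids are nonnegative reals. -/
structure IsSymmetricEquilibrium (n : ℕ) (f : ℝ → ℝ) (sbar : EReal) (c : ℝ) (k : ℕ) (δ : ℝ)
    (β : ℝ → ℝ) : Prop where
  strictMonoOn : StrictMonoOn β (openSupport sbar)
  nonneg : ∀ s ∈ openSupport sbar, 0 ≤ β s
  optimal : ∀ i : Fin n, ∀ x ∈ openSupport sbar, ∀ b : ℝ, 0 ≤ b →
    interimUtility n f c k δ β i x b ≤ interimUtility n f c k δ β i x (β x)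

/-- The outcome of the `δ`-mixed auction when all bidders follow `β`: the collection of ex-post
utilities as a function of the signals. -/
def outcome {n : ℕ} (c : ℝ) (k : ℕ) (δ : ℝ) (β : ℝ → ℝ) (s : Fin n → ℝ) (i : Fin n) : ℝ :=
  surplus c k δ s (fun j => β (s j)) i

/-- Dominance in pairwise differences among winners: for almost every signal profile, all absolute
pairwise differences of the winners' utilities are weakly smaller under `u` than under `u'`, and
one of them is strictly smaller. -/
def DominatesInPairwiseDifferences {n : ℕ} (f : ℝ → ℝ) (k : ℕ)
    (u u' : (Fin n → ℝ) → Fin n → ℝ) : Prop :=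
  ∀ᵐ s ∂(profileLaw n f),
    (∀ i j : Fin n, Wins k s i → Wins k s j → |u s i - u s j| ≤ |u' s i - u' s j|) ∧
    (∃ i j : Fin n, Wins k s i ∧ Wins k s j ∧ |u s i - u s j| < |u' s i - u' s j|)

end MixedAuction

end

/-!
When two winners have signals `x > y`, their utilities differ by `(1 - c) (x - y) - δ (β x - β y)`
under `δ`-mixed pricing and by `(1 - c) (x - y)` under uniform pricing. Since `0 < δ ≤ 2 (1 - c)`,
it is enough that `0 < β x - β y < x - y`: equilibrium bids increase, and more slowly than signals
(`equilibrium_sub_lt`).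

Let `G` and `g` be the distribution function and the density of the `k`-th highest opposing
signal, and `V z` the expected value of an item to a bidder of signal `z` for whom this opposing
signal is also `z`. Incentive compatibility with respect to deviations `β z` squeezes the
increments of the expected payment so tightly that `β` has to be differentiable, with
`β' = (V - β) g / (δ G)` (`hasDerivAt_of_increment_le`, `hasDerivAt_equilibrium`).

Two consequences of log-concavity then bound `β'`. The mean residual life `E[s | s > z] - z` of
the signals is decreasing and its mirror image `z - E[s | s ≤ z]` is increasing, so conditional
expectations of signals below or above `z` grow at rate at most one in `z`; as the weights in `V`
add up to one, `V x - V y ≤ x - y` (`IsPolyaDensity.pivotalValue_sub_le`). And `G` inherits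
log-concavity, so `g / G` is decreasing (`IsPolyaDensity.winDensity_mul_winProb_le`). A comparison
with `H = G ^ (1/δ)`, for which `(β H)' = V H'`, gives `β' ≤ H' / H² * ∫ H ≤ 1`, strictly because
`H` vanishes at `0` and therefore is not an exponential (`bid_slope_lt_one`).
-/

noncomputable section

namespace MixedAuction

open Set Filter Topology

/-! ### Log-concave densities on the line -/

/-- `f` is a Pólya frequency function of order two: `f (x + d) / f x` decreases in `x`, in the
division-free form that also makes sense where `f` vanishes. Unlike concavity of `log f`, it can
be stated for densities extended by zero to the whole line. -/
def IsPolyaTwo (f : ℝ → ℝ) : Prop :=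
  ∀ t x d : ℝ, t ≤ x → 0 ≤ d → f (x + d) * f t ≤ f x * f (t + d)

lemma IsPolyaTwo.comp_neg {f : ℝ → ℝ} (hf : IsPolyaTwo f) : IsPolyaTwo (fun t => f (-t)) := by
  intro t x d htx hd
  have h := hf (-(x + d)) (-(t + d)) d (by linarith) hd
  simp only [neg_add, neg_add_cancel_right] at h ⊢
  linarith [mul_comm (f (-t)) (f (-x + -d)), mul_comm (f (-x)) (f (-t + -d))]

lemma openSupport_ordConnected (sbar : EReal) : (openSupport sbar).OrdConnected := by
  refine ⟨fun x hx y hy z hz => ⟨lt_of_lt_of_le hx.1 hz.1, lt_of_le_of_lt ?_ hy.2⟩⟩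
  exact_mod_cast hz.2

lemma isOpen_openSupport (sbar : EReal) : IsOpen (openSupport sbar) :=
  (isOpen_lt continuous_const continuous_id).inter
    (isOpen_lt continuous_coe_real_ereal continuous_const)

/-- The points `x` and `t + d` lie between `t` and `x + d` and have the same sum, so concavity of
`log f` compares the two pairs. -/
lemma LogConcaveOn.isPolyaTwo {S : Set ℝ} {f : ℝ → ℝ} (hS : S.OrdConnected)
    (hpos : ∀ s ∈ S, 0 < f s) (hlc : LogConcaveOn S f) : IsPolyaTwo (S.indicator f) := by
  intro t x d htx hd
  have hnn : ∀ y, 0 ≤ S.indicator f y := fun y => indicator_nonneg (fun s hs => (hpos s hs).le) y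
  by_cases ht : t ∈ S
  swap
  · rw [indicator_of_notMem ht, mul_zero]; exact mul_nonneg (hnn _) (hnn _)
  by_cases hxd : x + d ∈ S
  swap
  · rw [indicator_of_notMem hxd, zero_mul]; exact mul_nonneg (hnn _) (hnn _)
  have hx : x ∈ S := hS.out ht hxd ⟨htx, by linarith⟩
  have htd : t + d ∈ S := hS.out ht hxd ⟨by linarith, by linarith⟩
  simp only [indicator_of_mem, ht, hxd, hx, htd]
  rcases (show t ≤ x + d by linarith).eq_or_lt with h | h
  · have h1 : d = 0 := by linarith
    have h2 : t = x := by linarith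
    subst h1 h2; simp
  have hw : 0 < x + d - t := by linarith
  have a0 : 0 ≤ (x - t) / (x + d - t) := div_nonneg (by linarith) hw.le
  have b0 : 0 ≤ d / (x + d - t) := div_nonneg hd hw.le
  have hab : (x - t) / (x + d - t) + d / (x + d - t) = 1 := by field_simp; ring
  have e1 := hlc.2 hxd ht a0 b0 hab
  have e2 := hlc.2 ht hxd a0 b0 hab
  simp only [smul_eq_mul] at e1 e2
  have c1 : (x - t) / (x + d - t) * (x + d) + d / (x + d - t) * t = x := by field_simp; ring
  have c2 : (x - t) / (x + d - t) * t + d / (x + d - t) * (x + d) = t + d := by field_simp; ring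
  rw [c1] at e1
  rw [c2] at e2
  have e3 : Real.log (f (x + d)) + Real.log (f t) ≤ Real.log (f x) + Real.log (f (t + d)) := by
    have : Real.log (f (x + d)) + Real.log (f t) =
      ((x - t) / (x + d - t) + d / (x + d - t)) * (Real.log (f (x + d)) + Real.log (f t)) := by
      rw [hab, one_mul]
    linarith
  rw [← Real.log_mul (hpos _ hxd).ne' (hpos _ ht).ne',
    ← Real.log_mul (hpos _ hx).ne' (hpos _ htd).ne'] at e3
  exact (Real.log_le_log_iff (mul_pos (hpos _ hxd) (hpos _ ht))
    (mul_pos (hpos _ hx) (hpos _ htd))).1 e3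

lemma LogConcaveOn.continuousOn {S : Set ℝ} {f : ℝ → ℝ} (hS : IsOpen S)
    (hpos : ∀ s ∈ S, 0 < f s) (hlc : LogConcaveOn S f) : ContinuousOn f S := by
  have h := (ConcaveOn.continuousOn hS hlc).rexp
  exact h.congr fun s hs => (Real.exp_log (hpos s hs)).symm

/-- The reversed hazard rate `f y / ∫ t in Iic y, f t` is decreasing. -/
lemma IsPolyaTwo.mul_integral_Iic_le {f : ℝ → ℝ} (hf : IsPolyaTwo f)
    (hi : Integrable f) {x y : ℝ} (hxy : x ≤ y) :
    f y * ∫ t in Iic x, f t ≤ f x * ∫ t in Iic y, f t := by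
  have hshift : ∫ t in Iic x, f (t + (y - x)) = ∫ t in Iic y, f t := by
    have := (measurePreserving_add_right volume (y - x)).setIntegral_preimage_emb
      (measurableEmbedding_addRight (y - x)) f (Iic y)
    rw [← this]
    congr 2
    ext t; simp
  rw [← hshift, ← integral_const_mul, ← integral_const_mul]
  refine setIntegral_mono_on (hi.integrableOn.const_mul _)
    ((hi.comp_add_right (y - x)).integrableOn.const_mul _) measurableSet_Iic fun t ht => ?_
  have := hf t x (y - x) ht (by linarith)
  simpa using this

/-- In terms of a random variable `s` with density `f`, this says that `y - E[s | s ≤ y]` is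
increasing in `y`. It is the integral over `t ≤ y` of the monotonicity of the reversed hazard
rate, because the tail formula turns the left-hand integral into that of the distribution
function. -/
lemma IsPolyaTwo.mul_integral_sub_le_sq {f : ℝ → ℝ} (hf : IsPolyaTwo f) (h0 : ∀ t, 0 ≤ f t)
    (hi : Integrable f) (hi1 : Integrable fun t => t * f t) (y : ℝ) :
    f y * ∫ t in Iic y, (y - t) * f t ≤ (∫ t in Iic y, f t) ^ 2 := by
  -- tail formula for the expectation of the positive part of `y - t`
  have hmeas : AEMeasurable (fun t => ENNReal.ofReal (f t)) volume :=
    hi.1.aemeasurable.ennreal_ofReal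
  set μ := volume.withDensity (fun t => ENNReal.ofReal (f t)) with hμ
  have hint : ∀ h : ℝ → ℝ, ∫ t, h t ∂μ = ∫ t, h t * f t := by
    intro h
    rw [hμ, integral_withDensity_eq_integral_toReal_smul₀ hmeas (by simp)]
    refine integral_congr_ae (.of_forall fun t => ?_)
    simp [ENNReal.toReal_ofReal (h0 t), mul_comm]
  have hreal : ∀ x, μ.real (Iio x) = ∫ t in Iic x, f t := by
    intro x
    rw [hμ, measureReal_def, withDensity_apply _ measurableSet_Iio,
      ← ofReal_integral_eq_lintegral_ofReal hi.integrableOn (.of_forall h0),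
      ENNReal.toReal_ofReal (setIntegral_nonneg measurableSet_Iio fun t _ => h0 t),
      integral_Iic_eq_integral_Iio]
  have hsi : IntegrableOn (fun t => (y - t) * f t) (Iic y) := by
    have : (fun t => (y - t) * f t) = fun t => y * f t - t * f t := by ext t; ring
    rw [this]
    exact ((hi.const_mul y).sub hi1).integrableOn
  have hind : (fun t => max (y - t) 0 * f t) = (Iic y).indicator (fun t => (y - t) * f t) := by
    ext t
    by_cases ht : t ≤ y
    · rw [indicator_of_mem (show t ∈ Iic y from ht), max_eq_left (by linarith)]
    · rw [indicator_of_notMem (show t ∉ Iic y from ht), max_eq_right (by linarith), zero_mul]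
  have hIμ : Integrable (fun t => max (y - t) 0) μ := by
    rw [hμ, integrable_withDensity_iff_integrable_smul₀' hmeas (by simp)]
    have : (fun t => (ENNReal.ofReal (f t)).toReal • max (y - t) 0) =
        (Iic y).indicator (fun t => (y - t) * f t) := by
      rw [← hind]; ext t; simp [ENNReal.toReal_ofReal (h0 t), mul_comm]
    rw [this]
    exact (integrable_indicator_iff measurableSet_Iic).2 hsi
  have hL : ∫ t in Iic y, (y - t) * f t = ∫ t in Ioi (0 : ℝ), ∫ s in Iic (y - t), f s := by
    rw [← integral_indicator measurableSet_Iic, ← hind, ← hint (fun t => max (y - t) 0),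
      hIμ.integral_eq_integral_meas_lt (.of_forall fun t => le_max_right _ _)]
    refine setIntegral_congr_fun measurableSet_Ioi fun t ht => ?_
    rw [← hreal]
    congr 1
    ext s
    have : 0 < t := ht
    simp only [mem_ofPred_eq, mem_Iio, lt_max_iff]
    constructor
    · rintro (h | h) <;> linarith
    · intro h; left; linarith
  have hR : ∫ t in Ioi (0 : ℝ), f (y - t) = ∫ t in Iic y, f t := by
    have := (Measure.measurePreserving_sub_left volume y).setIntegral_preimage_emb
      (measurableEmbedding_subLeft y) f (Iio y)
    rw [integral_Iic_eq_integral_Iio, ← this]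
    congr 2
    ext t; simp
  rw [hL, ← integral_const_mul, sq]
  nth_rewrite 2 [← hR]
  rw [← integral_const_mul]
  refine integral_mono_of_nonneg (.of_forall fun t => mul_nonneg (h0 y)
    (setIntegral_nonneg measurableSet_Iic fun s _ => h0 s))
    ((hi.comp_sub_left y).integrableOn.const_mul _) ?_
  refine (ae_restrict_iff' measurableSet_Ioi).2 (.of_forall fun t ht => ?_)
  have ht' : 0 < t := ht
  have := hf.mul_integral_Iic_le hi (show y - t ≤ y by linarith)
  simp only
  linarith

/-- The mirror image of `IsPolyaTwo.mul_integral_sub_le_sq`: the mean residual life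
`E[s | s > y] - y` is decreasing in `y`. -/
lemma IsPolyaTwo.mul_integral_sub_le_sq' {f : ℝ → ℝ} (hf : IsPolyaTwo f) (h0 : ∀ t, 0 ≤ f t)
    (hi : Integrable f) (hi1 : Integrable fun t => t * f t) (y : ℝ) :
    f y * ∫ t in Ioi y, (t - y) * f t ≤ (∫ t in Ioi y, f t) ^ 2 := by
  have h1 : Integrable fun t => t * f (-t) := by
    have := hi1.comp_neg.neg
    refine this.congr (.of_forall fun t => ?_)
    simp
  have h := hf.comp_neg.mul_integral_sub_le_sq (fun t => h0 _) hi.comp_neg h1 (-y)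
  have e1 := integral_comp_neg_Iic (-y) f
  have e2 := integral_comp_neg_Iic (-y) (fun t => (t - y) * f t)
  simp only [neg_neg] at e1 e2 h
  rw [e1] at h
  rw [← e2]
  convert h using 4
  ring

lemma hasDerivAt_integral_Iic {φ : ℝ → ℝ} (hφ : Integrable φ) {x : ℝ} (hx : ContinuousAt φ x) :
    HasDerivAt (fun z => ∫ t in Iic z, φ t) (φ x) x := by
  have h : (fun z => ∫ t in Iic z, φ t) = fun z => (∫ t in Iic x, φ t) + ∫ t in x..z, φ t := by
    ext z
    rw [← intervalIntegral.integral_Iic_sub_Iic hφ.integrableOn hφ.integrableOn]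
    ring
  rw [h]
  exact (intervalIntegral.integral_hasDerivAt_right (hφ.intervalIntegrable)
    hφ.1.stronglyMeasurableAtFilter hx).const_add _

lemma continuous_integral_Iic {φ : ℝ → ℝ} (hφ : Integrable φ) :
    Continuous (fun z => ∫ t in Iic z, φ t) := by
  have h : (fun z => ∫ t in Iic z, φ t) = fun z => (∫ t in Iic 0, φ t) + ∫ t in (0:ℝ)..z, φ t := by
    ext z
    rw [← intervalIntegral.integral_Iic_sub_Iic hφ.integrableOn hφ.integrableOn]
    ring
  rw [h]
  exact continuous_const.add (intervalIntegral.continuous_primitive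
    (fun a b => hφ.intervalIntegrable) 0)

/-- An envelope theorem without regularity assumptions on `P`: exchanging `y` and `z` in the
hypothesis squeezes each increment of `P` between those of `φ y * G` and `φ z * G`. -/
lemma hasDerivAt_of_increment_le {P φ G : ℝ → ℝ} {x g : ℝ} {S : Set ℝ} (hS : S ∈ 𝓝 x)
    (h : ∀ y ∈ S, ∀ z ∈ S, P y - P z ≤ φ y * (G y - G z)) (hφ : ContinuousAt φ x)
    (hG : HasDerivAt G g x) : HasDerivAt P (φ x * g) x := by
  have hx : x ∈ S := mem_of_mem_nhds hS
  have h1 : HasDerivAt (fun y => φ x * G y) (φ x * g) x := hG.const_mul _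
  have h2 : HasDerivAt (fun y => P y - φ x * G y) 0 x := by
    rw [hasDerivAt_iff_isLittleO]
    have hO : (fun y => G y - G x) =O[𝓝 x] fun y => y - x := hG.isBigO_sub
    have ho : (fun y => φ y - φ x) =o[𝓝 x] fun _ => (1 : ℝ) := by
      rw [Asymptotics.isLittleO_one_iff]
      exact tendsto_sub_nhds_zero_iff.2 hφ
    have hm := ho.mul_isBigO hO
    simp only [one_mul] at hm
    refine Asymptotics.IsBigO.trans_isLittleO ?_ hm
    refine Asymptotics.IsBigO.of_bound 1 ?_
    filter_upwards [hS] with y hy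
    have a := h y hy x hx
    have b := h x hx y hy
    simp only [smul_zero, sub_zero, one_mul, Real.norm_eq_abs]
    have e : P y - φ x * G y - (P x - φ x * G x) = P y - P x - φ x * (G y - G x) := by ring
    rw [e, abs_of_nonneg (by linarith)]
    refine le_trans ?_ (le_abs_self _)
    linarith
  have h3 := h2.add h1
  rw [zero_add] at h3
  exact h3.congr_of_eventuallyEq (.of_forall fun y => by simp)

/-! ### Binomial tails -/

/-- The probability that fewer than `k` of `N` independent events of probability `q` occur. -/
def binomialTail (N k : ℕ) (q : ℝ) : ℝ :=
  ∑ a ∈ Finset.range k, (bernsteinPolynomial ℝ N a).eval q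

lemma bernstein_eval (N a : ℕ) (q : ℝ) :
    (bernsteinPolynomial ℝ N a).eval q = (N.choose a : ℝ) * q ^ a * (1 - q) ^ (N - a) := by
  simp [bernsteinPolynomial]

lemma binomialTail_succ (N k : ℕ) (q : ℝ) :
    binomialTail N (k + 1) q = binomialTail N k q + (bernsteinPolynomial ℝ N k).eval q :=
  Finset.sum_range_succ _ _

/-- The derivatives of the Bernstein polynomials telescope. -/
lemma hasDerivAt_binomialTail (N k : ℕ) (q : ℝ) :
    HasDerivAt (binomialTail N (k + 1)) (-(N * (bernsteinPolynomial ℝ (N - 1) k).eval q)) q := by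
  induction k with
  | zero =>
    have h := (bernsteinPolynomial ℝ N 0).hasDerivAt q
    rw [bernsteinPolynomial.derivative_zero] at h
    have e : binomialTail N (0 + 1) = fun x => (bernsteinPolynomial ℝ N 0).eval x := by
      ext x; simp [binomialTail]
    rw [e]
    simpa using h
  | succ k ih =>
    have h := ih.add ((bernsteinPolynomial ℝ N (k + 1)).hasDerivAt q)
    rw [bernsteinPolynomial.derivative_succ] at h
    have e : binomialTail N (k + 1 + 1) =
        binomialTail N (k + 1) + fun x => (bernsteinPolynomial ℝ N (k + 1)).eval x := by
      ext x; exact binomialTail_succ _ _ _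
    rw [e]
    refine h.congr_deriv ?_
    simp only [Polynomial.eval_mul, Polynomial.eval_sub, Polynomial.eval_natCast]
    ring

lemma binomialTail_pos {N k : ℕ} {q : ℝ} (h0 : 0 ≤ q) (h1 : q < 1) :
    0 < binomialTail N (k + 1) q := by
  have h1' : 0 < 1 - q := by linarith
  refine Finset.sum_pos' (fun a _ => ?_) ⟨0, by simp, ?_⟩
  · rw [bernstein_eval]; positivity
  · rw [bernstein_eval]; simp; positivity

lemma binomialTail_one {N k : ℕ} (h : k ≤ N) : binomialTail N k 1 = 0 := by
  refine Finset.sum_eq_zero fun a ha => ?_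
  rw [bernsteinPolynomial.eval_at_1, if_neg]
  have := Finset.mem_range.1 ha
  omega

lemma bernstein_eval_mul_one_sub (m K : ℕ) (q : ℝ) :
    ((m + K + 1 : ℕ) : ℝ) * (bernsteinPolynomial ℝ (m + K) (K + 1)).eval q * (1 - q) =
      m * (bernsteinPolynomial ℝ (m + K + 1) (K + 1)).eval q := by
  rw [bernstein_eval, bernstein_eval]
  rcases m with _ | m
  · simp
  have h := Nat.choose_mul_succ_eq (m + 1 + K) (K + 1)
  have e1 : m + 1 + K - (K + 1) = m := by omega
  have e2 : m + 1 + K + 1 - (K + 1) = m + 1 := by omega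
  rw [e2] at h
  rw [e1, e2]
  have h' : ((m + 1 + K).choose (K + 1) : ℝ) * ((m + 1 + K + 1 : ℕ) : ℝ) =
    ((m + 1 + K + 1).choose (K + 1) : ℝ) * ((m + 1 : ℕ) : ℝ) := by exact_mod_cast h
  linear_combination q ^ (K + 1) * (1 - q) ^ (m + 1) * h'

lemma bernstein_eval_mul (m K : ℕ) (q : ℝ) :
    ((m + K + 1 : ℕ) : ℝ) * (bernsteinPolynomial ℝ (m + K) K).eval q * q =
      ((K + 1 : ℕ) : ℝ) * (bernsteinPolynomial ℝ (m + K + 1) (K + 1)).eval q := by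
  rw [bernstein_eval, bernstein_eval]
  have h := Nat.add_one_mul_choose_eq (m + K) K
  have e1 : m + K - K = m := by omega
  have e2 : m + K + 1 - (K + 1) = m := by omega
  rw [e1, e2]
  have h' : ((m + K + 1 : ℕ) : ℝ) * ((m + K).choose K : ℝ) =
    ((m + K + 1).choose (K + 1) : ℝ) * ((K + 1 : ℕ) : ℝ) := by exact_mod_cast h
  linear_combination q ^ (K + 1) * (1 - q) ^ m * h'

/-- With `b p` the Bernstein polynomial and `A p` the binomial tail at `1 - p`, so that
`A' = N b`, the elasticity `p * b p / A p` is decreasing: rescaling the primitive gives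
`A p / p = N ∫ b (p u) du` over `u ∈ [0, 1]`, and `b (p u) / b p` increases in `p` for each such
`u`. -/
lemma mul_bernstein_mul_binomialTail_le (m K : ℕ) {p₁ p₂ : ℝ} (h0 : 0 < p₁) (h12 : p₁ ≤ p₂)
    (h1 : p₂ < 1) :
    p₂ * (bernsteinPolynomial ℝ (m + K + 1) (K + 1)).eval (1 - p₂) *
        binomialTail (m + K + 2) (K + 2) (1 - p₁) ≤
      p₁ * (bernsteinPolynomial ℝ (m + K + 1) (K + 1)).eval (1 - p₁) *
        binomialTail (m + K + 2) (K + 2) (1 - p₂) := by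
  set b : ℝ → ℝ := fun p => (bernsteinPolynomial ℝ (m + K + 1) (K + 1)).eval (1 - p) with hb
  set A : ℝ → ℝ := fun p => binomialTail (m + K + 2) (K + 2) (1 - p) with hA
  set N : ℝ := ((m + K + 2 : ℕ) : ℝ)
  have hp2 : 0 < p₂ := h0.trans_le h12
  have hAd : ∀ p, HasDerivAt A (N * b p) p := by
    intro p
    have h := (hasDerivAt_binomialTail (m + K + 2) (K + 1) (1 - p)).comp p
      ((hasDerivAt_id p).const_sub 1)
    have h2 : HasDerivAt A _ p := h
    convert h2 using 1
    simp [N, hb]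
  set l := p₁ / p₂ with hl
  have hl0 : 0 < l := div_pos h0 hp2
  have hl1 : l ≤ 1 := (div_le_one hp2).2 h12
  have hlp : l * p₂ = p₁ := div_mul_cancel₀ _ hp2.ne'
  have hbe : ∀ p, b p = ((m + K + 1).choose (K + 1) : ℝ) * (1 - p) ^ (K + 1) * p ^ m := by
    intro p
    have e2 : m + K + 1 - (K + 1) = m := by omega
    simp only [hb]
    rw [bernstein_eval, e2, sub_sub_cancel]
  -- the powers of `p` cancel, and only `(1 - p₂)(1 - l u) ≤ (1 - p₁)(1 - u)` matters
  have key : ∀ u ∈ Icc 0 p₂, b p₂ * b (l * u) ≤ b p₁ * b u := by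
    intro u hu
    simp only [hbe, ← hlp]
    have hlu : l * u ≤ p₂ := by nlinarith [hu.1, hu.2]
    have h3 : (1 - p₂) * (1 - l * u) ≤ (1 - l * p₂) * (1 - u) := by
      nlinarith [mul_nonneg (sub_nonneg.2 hl1) (sub_nonneg.2 hu.2)]
    have h4 : ((1 - p₂) * (1 - l * u)) ^ (K + 1) ≤ ((1 - l * p₂) * (1 - u)) ^ (K + 1) :=
      pow_le_pow_left₀ (mul_nonneg (by linarith) (by linarith)) h3 _
    set C := ((m + K + 1).choose (K + 1) : ℝ)
    have hc : 0 ≤ C ^ 2 * (l * p₂ * u) ^ m :=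
      mul_nonneg (sq_nonneg _) (pow_nonneg (mul_nonneg (by positivity) hu.1) _)
    calc _ = C ^ 2 * (l * p₂ * u) ^ m * ((1 - p₂) * (1 - l * u)) ^ (K + 1) := by
          simp only [mul_pow]; ring
      _ ≤ C ^ 2 * (l * p₂ * u) ^ m * ((1 - l * p₂) * (1 - u)) ^ (K + 1) :=
        mul_le_mul_of_nonneg_left h4 hc
      _ = _ := by simp only [mul_pow]; ring
  -- compare the primitives of `u ↦ b p₁ * b u` and `u ↦ b p₂ * b (l * u)`
  have hχ : ∀ u, HasDerivAt (fun u => l * b p₁ * A u - b p₂ * A (l * u))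
      (N * l * (b p₁ * b u - b p₂ * b (l * u))) u := by
    intro u
    have h2 : HasDerivAt (fun u => A (l * u)) (N * b (l * u) * (l * 1)) u :=
      (hAd (l * u)).comp u ((hasDerivAt_id u).const_mul l)
    exact (((hAd u).const_mul (l * b p₁)).sub (h2.const_mul (b p₂))).congr_deriv (by ring)
  have hmono : MonotoneOn (fun u => l * b p₁ * A u - b p₂ * A (l * u)) (Icc 0 p₂) := by
    refine monotoneOn_of_deriv_nonneg (convex_Icc _ _)
      (fun u _ => (hχ u).continuousAt.continuousWithinAt)
      (fun u _ => (hχ u).differentiableAt.differentiableWithinAt) fun u hu => ?_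
    rw [(hχ u).deriv]
    have := key u (interior_subset hu)
    exact mul_nonneg (by positivity) (by linarith)
  have hA0 : A 0 = 0 := by
    simp only [hA, sub_zero]
    exact binomialTail_one (by omega)
  have hfin := hmono (left_mem_Icc.2 hp2.le) (right_mem_Icc.2 hp2.le) hp2.le
  simp only [mul_zero, hA0, sub_zero, hlp] at hfin
  have : 0 ≤ p₂ * (l * b p₁ * A p₂ - b p₂ * A p₁) := mul_nonneg hp2.le hfin
  have e : p₂ * (l * b p₁ * A p₂ - b p₂ * A p₁) =
    (l * p₂) * b p₁ * A p₂ - p₂ * b p₂ * A p₁ := by ring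
  rw [e, hlp] at this
  linarith

/-! ### Comparison for the bidding equation -/

/-- Comparison for the bidding equation `β' = ρ (V - β)`, where `ρ = g / (δ G)`. Let
`H = G ^ (1/δ)`, so that `H' = ρ H`. For fixed `x`, the function
`y ↦ ρ x * ((V x - β y - (x - y)) * H y) - H y` has derivative at most `(ρ x - ρ y) H y ≤ 0` and
vanishes at `0+`, so it is nonpositive at `y = x`, which is `β' x ≤ 1`. The inequality is strict
since `ρ` is not constant near `0`. -/
lemma bid_slope_lt_one {sbar : EReal} {G g V β : ℝ → ℝ} {δ : ℝ} (hδ : 0 < δ)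
    (hG : ∀ y ∈ openSupport sbar, 0 < G y) (hg : ∀ y ∈ openSupport sbar, 0 < g y)
    (hGg : ∀ y ∈ openSupport sbar, HasDerivAt G (g y) y)
    (hanti : ∀ x ∈ openSupport sbar, ∀ y ∈ openSupport sbar, x ≤ y → g y * G x ≤ g x * G y)
    (hG0 : Tendsto G (𝓝[>] 0) (𝓝 0))
    (hV : ∀ y ∈ openSupport sbar, ∀ x ∈ openSupport sbar, y ≤ x → V x - V y ≤ x - y)
    (hβ0 : ∀ y ∈ openSupport sbar, 0 ≤ β y) (hβm : MonotoneOn β (openSupport sbar))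
    (hβ : ∀ y ∈ openSupport sbar, HasDerivAt β ((V y - β y) * g y / (δ * G y)) y)
    {x : ℝ} (hx : x ∈ openSupport sbar) : (V x - β x) * g x / (δ * G x) < 1 := by
  have hsub : ∀ y, 0 < y → y ≤ x → y ∈ openSupport sbar := fun y h0 h1 =>
    ⟨h0, lt_of_le_of_lt (by exact_mod_cast h1) hx.2⟩
  set ρ : ℝ → ℝ := fun y => g y / (δ * G y) with hρ
  set H : ℝ → ℝ := fun y => G y ^ (1 / δ) with hH
  have hHpos : ∀ y ∈ openSupport sbar, 0 < H y := fun y hy => Real.rpow_pos_of_pos (hG y hy) _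
  have hρpos : ∀ y ∈ openSupport sbar, 0 < ρ y := fun y hy =>
    div_pos (hg y hy) (mul_pos hδ (hG y hy))
  have hρanti : ∀ y ∈ openSupport sbar, ∀ z ∈ openSupport sbar, y ≤ z → ρ z ≤ ρ y := by
    intro y hy z hz hyz
    simp only [hρ]
    rw [div_le_div_iff₀ (mul_pos hδ (hG z hz)) (mul_pos hδ (hG y hy))]
    have := mul_le_mul_of_nonneg_left (hanti y hy z hz hyz) hδ.le
    linarith
  have hHd : ∀ y ∈ openSupport sbar, HasDerivAt H (ρ y * H y) y := by
    intro y hy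
    have h := (hGg y hy).rpow_const (p := 1 / δ) (Or.inl (hG y hy).ne')
    convert h using 1
    rw [Real.rpow_sub_one (hG y hy).ne']
    simp only [hρ, hH]
    have := (hG y hy).ne'
    field_simp
  have hβ' : ∀ y ∈ openSupport sbar, HasDerivAt β ((V y - β y) * ρ y) y := by
    intro y hy
    convert hβ y hy using 1
    simp only [hρ]; ring
  have hH0 : Tendsto H (𝓝[>] 0) (𝓝 0) := by
    have := hG0.rpow_const (p := 1 / δ) (Or.inr (by positivity))
    rwa [Real.zero_rpow (by positivity)] at this
  set Θ : ℝ → ℝ := fun y => (V x - β y - (x - y)) * H y with hΘ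
  have hΘd : ∀ y ∈ openSupport sbar,
      HasDerivAt Θ (H y + ρ y * H y * (V x - V y - (x - y))) y := by
    intro y hy
    have h1 : HasDerivAt (fun y => V x - β y - (x - y)) (-((V y - β y) * ρ y) - -1) y :=
      ((hβ' y hy).const_sub _).sub ((hasDerivAt_id y).const_sub x)
    exact (h1.mul (hHd y hy)).congr_deriv (by ring)
  -- the comparison is run for a general weight `r`, since strictness uses one other than `ρ x`
  have hanti' : ∀ r y₁, 0 ≤ r → y₁ ≤ x → (∀ y, 0 < y → y ≤ y₁ → r ≤ ρ y) →
      AntitoneOn (fun y => r * Θ y - H y) (Ioc 0 y₁) := by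
    intro r y₁ hr hy₁ hry
    have hd : ∀ y ∈ Ioc 0 y₁, HasDerivAt (fun y => r * Θ y - H y)
        (r * (H y + ρ y * H y * (V x - V y - (x - y))) - ρ y * H y) y := fun y hy =>
      ((hΘd y (hsub y hy.1 (hy.2.trans hy₁))).const_mul r).sub
        (hHd y (hsub y hy.1 (hy.2.trans hy₁)))
    refine antitoneOn_of_deriv_nonpos (convex_Ioc _ _)
      (fun y hy => (hd y hy).continuousAt.continuousWithinAt)
      (fun y hy => (hd y (interior_subset hy)).differentiableAt.differentiableWithinAt)
      fun y hy => ?_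
    have hy := interior_subset hy
    have hyS := hsub y hy.1 (hy.2.trans hy₁)
    rw [(hd y hy).deriv]
    have a1 := hV y hyS x hx (hy.2.trans hy₁)
    have a2 := hHpos y hyS
    have a3 := hρpos y hyS
    have a4 : r * (ρ y * H y) * (V x - V y - (x - y)) ≤ 0 :=
      mul_nonpos_of_nonneg_of_nonpos (by positivity) (by linarith)
    have a5 := mul_le_mul_of_nonneg_right (hry y hy.1 hy.2) a2.le
    linarith
  have hlim : ∀ r, Tendsto (fun y => r * Θ y - H y) (𝓝[>] 0) (𝓝 0) := by
    intro r
    have hΘ0 : Tendsto Θ (𝓝[>] 0) (𝓝 0) := by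
      refine squeeze_zero_norm' (a := fun y => (|V x| + β x + x) * H y) ?_
        (by simpa using hH0.const_mul (|V x| + β x + x))
      filter_upwards [Ioc_mem_nhdsGT hx.1] with y hy
      have hyS := hsub y hy.1 hy.2
      simp only [hΘ, norm_mul, Real.norm_eq_abs, abs_of_pos (hHpos y hyS)]
      refine mul_le_mul_of_nonneg_right ?_ (hHpos y hyS).le
      have b1 := hβ0 y hyS
      have b2 := hβm hyS hx hy.2
      have b3 := hy.1
      have b4 := hy.2
      rw [abs_le]
      constructor <;> linarith [neg_abs_le (V x), le_abs_self (V x)]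
    simpa using (hΘ0.const_mul r).sub hH0
  have hle : ∀ r y₁, 0 ≤ r → 0 < y₁ → y₁ ≤ x → (∀ y, 0 < y → y ≤ y₁ → r ≤ ρ y) →
      r * Θ y₁ - H y₁ ≤ 0 := by
    intro r y₁ hr h0 h1 hry
    refine ge_of_tendsto (hlim r) ?_
    filter_upwards [Ioc_mem_nhdsGT h0] with y hy
    exact hanti' r y₁ hr h1 hry hy ⟨h0, le_rfl⟩ hy.2
  -- `ρ` is the logarithmic derivative of `H`, which vanishes at `0`, so `ρ` is not constant
  obtain ⟨y₁, hy0, hyx, hρy⟩ : ∃ y₁, 0 < y₁ ∧ y₁ ≤ x ∧ ρ x < ρ y₁ := by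
    by_contra! hcon
    have hd : ∀ y ∈ Ioc 0 x, HasDerivAt (fun y => Real.log (H y) - ρ x * y)
        (ρ y * H y / H y - ρ x * 1) y := fun y hy =>
      ((hHd y (hsub y hy.1 hy.2)).log (hHpos y (hsub y hy.1 hy.2)).ne').sub
        ((hasDerivAt_id y).const_mul _)
    have hA : AntitoneOn (fun y => Real.log (H y) - ρ x * y) (Ioc 0 x) := by
      refine antitoneOn_of_deriv_nonpos (convex_Ioc _ _)
        (fun y hy => (hd y hy).continuousAt.continuousWithinAt)
        (fun y hy => (hd y (interior_subset hy)).differentiableAt.differentiableWithinAt)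
        fun y hy => ?_
      have hy := interior_subset hy
      rw [(hd y hy).deriv, mul_div_cancel_right₀ _ (hHpos y (hsub y hy.1 hy.2)).ne']
      linarith [hcon y hy.1 hy.2]
    have hexp : ∀ y ∈ Ioc 0 x, Real.exp (Real.log (H x) - ρ x * x) ≤ H y := by
      intro y hy
      rw [← Real.le_log_iff_exp_le (hHpos y (hsub y hy.1 hy.2))]
      have h1 := hA hy (right_mem_Ioc.2 hx.1) hy.2
      simp only at h1
      have := mul_pos (hρpos x hx) hy.1
      linarith
    have h0 : Real.exp (Real.log (H x) - ρ x * x) ≤ 0 := by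
      refine ge_of_tendsto hH0 ?_
      filter_upwards [Ioc_mem_nhdsGT hx.1] with y hy using hexp y hy
    exact absurd h0 (not_le.2 (Real.exp_pos _))
  have hyS := hsub y₁ hy0 hyx
  have s1 : ρ x * Θ y₁ < H y₁ := by
    have := hle (ρ y₁) y₁ (hρpos _ hyS).le hy0 hyx fun y h0 h1 =>
      hρanti y (hsub y h0 (h1.trans hyx)) y₁ hyS h1
    rcases le_or_gt (Θ y₁) 0 with h | h
    · exact (mul_nonpos_of_nonneg_of_nonpos (hρpos x hx).le h).trans_lt (hHpos _ hyS)
    · have := mul_lt_mul_of_pos_right hρy h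
      linarith
  have s2 := hanti' (ρ x) x (hρpos x hx).le le_rfl
    (fun y h0 h1 => hρanti y (hsub y h0 h1) x hx h1) ⟨hy0, hyx⟩ (right_mem_Ioc.2 hx.1) hyx
  have s3 : ρ x * (V x - β x) * H x < 1 * H x := by
    simp only [hΘ, sub_self, sub_zero] at s2 s1
    linarith
  have s4 := lt_of_mul_lt_mul_right s3 (hHpos x hx).le
  calc _ = ρ x * (V x - β x) := by simp only [hρ]; ring
    _ < 1 := s4

/-! ### Order statistics of independent signals -/

lemma le_card_filter_iff {n : ℕ} (m : ℕ) (x : Fin n → ℝ) (t : ℝ) :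
    m ≤ (Finset.univ.filter (fun j => t ≤ x j)).card ↔
      ∃ B ∈ Finset.powersetCard m (Finset.univ : Finset (Fin n)), ∀ j ∈ B, t ≤ x j := by
  constructor
  · intro h
    obtain ⟨B, hB, hc⟩ := Finset.exists_subset_card_eq h
    exact ⟨B, Finset.mem_powersetCard.2 ⟨Finset.subset_univ _, hc⟩,
      fun j hj => (Finset.mem_filter.1 (hB hj)).2⟩
  · rintro ⟨B, hB, hj⟩
    rw [← (Finset.mem_powersetCard.1 hB).2]
    exact Finset.card_le_card fun j h => Finset.mem_filter.2 ⟨Finset.mem_univ _, hj j h⟩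

/-- The supremum defining `kthHighest` is attained, so it is characterized by counting. -/
lemma le_kthHighest_iff {n m : ℕ} (hm : 1 ≤ m) (hmn : m ≤ n) (x : Fin n → ℝ) (t : ℝ) :
    t ≤ kthHighest m x ↔ m ≤ (Finset.univ.filter (fun j => t ≤ x j)).card := by
  set A := {t : ℝ | m ≤ (Finset.univ.filter (fun j => t ≤ x j)).card} with hA
  have hcl : IsClosed A := by
    have e : A = ⋃ B ∈ (Finset.powersetCard m (Finset.univ : Finset (Fin n)) :
        Set (Finset (Fin n))), {t : ℝ | ∀ j ∈ B, t ≤ x j} := by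
      ext t
      simp only [hA, mem_ofPred_eq, le_card_filter_iff, mem_iUnion, Finset.mem_coe, exists_prop]
    rw [e]
    refine (Finset.finite_toSet _).isClosed_biUnion fun B _ => ?_
    simp only [ofPred_forall]
    exact isClosed_iInter fun j => isClosed_iInter fun _ => isClosed_Iic
  have hbdd : BddAbove A := by
    refine ⟨∑ j, |x j|, fun t ht => ?_⟩
    have hpos : 0 < (Finset.univ.filter (fun j => t ≤ x j)).card := lt_of_lt_of_le hm ht
    obtain ⟨j, hj⟩ := Finset.card_pos.1 hpos
    calc t ≤ x j := (Finset.mem_filter.1 hj).2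
      _ ≤ |x j| := le_abs_self _
      _ ≤ _ := Finset.single_le_sum (f := fun j => |x j|) (fun j _ => abs_nonneg _)
        (Finset.mem_univ j)
  have hne : A.Nonempty := by
    refine ⟨-∑ j, |x j|, ?_⟩
    have : Finset.univ.filter (fun j => -∑ j, |x j| ≤ x j) = Finset.univ := by
      refine Finset.filter_true_of_mem fun j _ => ?_
      have := Finset.single_le_sum (f := fun j => |x j|) (fun j _ => abs_nonneg _)
        (Finset.mem_univ j)
      linarith [neg_abs_le (x j)]
    simp only [hA, mem_ofPred_eq, this, Finset.card_univ, Fintype.card_fin, hmn]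
  have hmem : sSup A ∈ A := hcl.csSup_mem hne hbdd
  constructor
  · intro h
    refine le_trans (show m ≤ _ from hmem) (Finset.card_le_card fun j hj => ?_)
    simp only [Finset.mem_filter, Finset.mem_univ, true_and] at hj ⊢
    exact le_trans h hj
  · intro h
    exact le_csSup hbdd h

lemma wins_iff {n k : ℕ} (hkn : k < n) (x : Fin n → ℝ) (i : Fin n) :
    Wins k x i ↔ (Finset.univ.filter (fun j => x i ≤ x j)).card ≤ k := by
  rw [Wins, ← not_le, le_kthHighest_iff (by omega) hkn]
  omega

lemma measurable_kthHighest {n m : ℕ} (hm : 1 ≤ m) (hmn : m ≤ n) :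
    Measurable (kthHighest m : (Fin n → ℝ) → ℝ) := by
  refine measurable_of_Ici fun t => ?_
  have e : kthHighest m ⁻¹' Ici t =
      ⋃ B ∈ Finset.powersetCard m (Finset.univ : Finset (Fin n)),
        ⋂ j ∈ B, {x : Fin n → ℝ | t ≤ x j} := by
    ext x
    simp only [mem_preimage, mem_Ici, le_kthHighest_iff hm hmn, le_card_filter_iff, mem_iUnion,
      mem_iInter, mem_ofPred_eq, exists_prop]
  rw [e]
  refine Finset.measurableSet_biUnion _ fun B _ => Finset.measurableSet_biInter _ fun j _ => ?_
  exact measurableSet_le measurable_const (measurable_pi_apply j)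

/-- The bidders with the two highest signals win. -/
lemma exists_two_winners {n k : ℕ} (hk : 2 ≤ k) (hkn : k < n) {s : Fin n → ℝ}
    (hs : Function.Injective s) : ∃ i j, i ≠ j ∧ Wins k s i ∧ Wins k s j := by
  have hne : (Finset.univ : Finset (Fin n)).Nonempty := ⟨⟨0, by omega⟩, Finset.mem_univ _⟩
  obtain ⟨i, -, hi⟩ := Finset.exists_max_image Finset.univ s hne
  have hne2 : ((Finset.univ : Finset (Fin n)).erase i).Nonempty := by
    rw [← Finset.card_pos, Finset.card_erase_of_mem (Finset.mem_univ _), Finset.card_univ,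
      Fintype.card_fin]
    omega
  obtain ⟨j, hj, hj'⟩ := Finset.exists_max_image _ s hne2
  have hij : i ≠ j := (Finset.ne_of_mem_erase hj).symm
  have key : ∀ l, s j ≤ s l → l = i ∨ l = j := by
    intro l hl
    by_contra! hcon
    have := hj' l (Finset.mem_erase.2 ⟨hcon.1, Finset.mem_univ _⟩)
    exact hcon.2 (hs (le_antisymm this hl))
  have hcard : ∀ t, s j ≤ t → (Finset.univ.filter (fun l => t ≤ s l)).card ≤ k := by
    intro t ht
    refine le_trans (Finset.card_le_card (t := {i, j}) fun l hl => ?_) (Finset.card_le_two.trans hk)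
    rcases key l (ht.trans (Finset.mem_filter.1 hl).2) with h | h <;> simp [h]
  exact ⟨i, j, hij, (wins_iff hkn s i).2 (hcard _ (hi j (Finset.mem_univ _))),
    (wins_iff hkn s j).2 (hcard _ le_rfl)⟩

/-- Expansion over the set `A` of coordinates in `S` that reach `z`: a function of the number of
such coordinates is a sum of products of functions of single coordinates. -/
lemma apply_card_filter_eq_sum {ι : Type*} [DecidableEq ι] (S : Finset ι) (φ : ℕ → ℝ)
    (z : ℝ) (s : ι → ℝ) :
    φ (S.filter (fun j => z ≤ s j)).card = ∑ A ∈ S.powerset, φ A.card *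
      ∏ j ∈ S, (if j ∈ A then (Ici z).indicator 1 (s j) else (Iio z).indicator 1 (s j)) := by
  rw [Finset.sum_eq_single (S.filter (fun j => z ≤ s j))]
  · rw [Finset.prod_eq_one, mul_one]
    intro j hj
    by_cases h : z ≤ s j
    · simp [hj, h]
    · simp [h, not_le.1 h]
  · intro A hA hne
    have hAS := Finset.mem_powerset.1 hA
    have : ∃ j ∈ S, ¬ (j ∈ A ↔ z ≤ s j) := by
      by_contra! hcon
      refine hne (Finset.ext fun j => ?_)
      rw [Finset.mem_filter]
      exact ⟨fun hj => ⟨hAS hj, (hcon j (hAS hj)).1 hj⟩, fun hj => (hcon j hj.1).2 hj.2⟩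
    obtain ⟨j, hjS, hj⟩ := this
    rw [Finset.prod_eq_zero hjS, mul_zero]
    by_cases h : j ∈ A
    · have : s j < z := by simpa [h] using hj
      simp [h, this]
    · have : z ≤ s j := by simpa [h] using hj
      simp [h, this]
  · intro h
    exact absurd (Finset.mem_powerset.2 (Finset.filter_subset _ _)) h

lemma integral_mul_apply_card_filter {ι : Type*} [Fintype ι] [DecidableEq ι]
    {μ : Measure ℝ} [IsProbabilityMeasure μ] {S : Finset ι}
    {l : ι} (hl : l ∉ S) {ψ : ℝ → ℝ} (hψ : Integrable ψ μ) (φ : ℕ → ℝ) (z : ℝ) :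
    ∫ s, ψ (s l) * φ (S.filter (fun j => z ≤ s j)).card ∂(Measure.pi fun _ : ι => μ) =
      (∫ t, ψ t ∂μ) * ∑ a ∈ Finset.range (S.card + 1),
        (S.card.choose a : ℝ) *
          (φ a * (μ.real (Ici z) ^ a * (1 - μ.real (Ici z)) ^ (S.card - a))) := by
  set h : Finset ι → ι → ℝ → ℝ := fun A j =>
    if j = l then ψ else if j ∈ A then (Ici z).indicator 1 else if j ∈ S then (Iio z).indicator 1
      else 1 with hh
  have hint : ∀ A j, Integrable (h A j) μ := by
    intro A j
    simp only [hh]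
    split_ifs
    · exact hψ
    · exact (integrable_const (1 : ℝ)).indicator measurableSet_Ici
    · exact (integrable_const (1 : ℝ)).indicator measurableSet_Iio
    · exact integrable_const (1 : ℝ)
  have hprod : ∀ A ∈ S.powerset, ∀ s : ι → ℝ, ∏ j, h A j (s j) = ψ (s l) *
      ∏ j ∈ S, (if j ∈ A then (Ici z).indicator 1 (s j) else (Iio z).indicator 1 (s j)) := by
    intro A hA s
    have hAS := Finset.mem_powerset.1 hA
    rw [← Finset.mul_prod_erase _ _ (Finset.mem_univ l)]
    have hsub : S ⊆ Finset.univ.erase l := fun j hj =>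
      Finset.mem_erase.2 ⟨fun e => hl (e ▸ hj), Finset.mem_univ _⟩
    rw [← Finset.prod_subset hsub]
    · congr 1
      · simp [hh]
      · refine Finset.prod_congr rfl fun j hj => ?_
        have hjl : j ≠ l := fun e => hl (e ▸ hj)
        simp only [hh, hjl, if_false, hj, if_true]
        split_ifs <;> rfl
    · intro j hj hjS
      have hjl := Finset.ne_of_mem_erase hj
      have hjA : j ∉ A := fun e => hjS (hAS e)
      simp [hh, hjl, hjA, hjS]
  have hIio : μ.real (Iio z) = 1 - μ.real (Ici z) := by
    rw [← probReal_compl_eq_one_sub measurableSet_Ici, compl_Ici]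
  have hval : ∀ A ∈ S.powerset, ∏ j, ∫ t, h A j t ∂μ =
      (∫ t, ψ t ∂μ) * (μ.real (Ici z) ^ A.card * (1 - μ.real (Ici z)) ^ (S.card - A.card)) := by
    intro A hA
    have hAS := Finset.mem_powerset.1 hA
    have hlA : l ∉ A := fun e => hl (hAS e)
    have e : ∀ j, ∫ t, h A j t ∂μ = (if j = l then ∫ t, ψ t ∂μ else 1) *
        ((if j ∈ A then μ.real (Ici z) else 1) *
          (if j ∈ S \ A then 1 - μ.real (Ici z) else 1)) := by
      intro j
      simp only [hh, Finset.mem_sdiff]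
      by_cases hjl : j = l
      · subst hjl; simp [hlA, hl]
      by_cases hjA : j ∈ A
      · simp [hjl, hjA, hAS hjA, integral_indicator_one measurableSet_Ici]
      by_cases hjS : j ∈ S
      · simp [hjl, hjA, hjS, integral_indicator_one measurableSet_Iio, hIio]
      · simp [hjl, hjA, hjS]
    simp only [e, Finset.prod_mul_distrib]
    rw [Finset.prod_ite_eq', Finset.prod_ite_mem, Finset.prod_ite_mem]
    simp [Finset.card_sdiff_of_subset hAS]
  have e1 : ∀ s : ι → ℝ, ψ (s l) * φ (S.filter (fun j => z ≤ s j)).card =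
      ∑ A ∈ S.powerset, φ A.card * ∏ j, h A j (s j) := by
    intro s
    rw [apply_card_filter_eq_sum S φ, Finset.mul_sum]
    refine Finset.sum_congr rfl fun A hA => ?_
    rw [hprod A hA s]; ring
  simp only [e1]
  rw [integral_finsetSum _ fun A _ => (Integrable.fintype_prod (fun j => hint A j)).const_mul _]
  have e2 : ∀ A ∈ S.powerset, ∫ s, φ A.card * ∏ j, h A j (s j) ∂(Measure.pi fun _ : ι => μ) =
      (∫ t, ψ t ∂μ) * (φ A.card * (μ.real (Ici z) ^ A.card *
        (1 - μ.real (Ici z)) ^ (S.card - A.card))) := by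
    intro A hA
    rw [integral_const_mul, integral_fintype_prod_eq_prod, hval A hA]; ring
  rw [Finset.sum_congr rfl e2, ← Finset.mul_sum]
  congr 1
  rw [Finset.sum_powerset_apply_card (fun a => φ a * (μ.real (Ici z) ^ a *
        (1 - μ.real (Ici z)) ^ (S.card - a)))]
  simp

/-- For independent coordinates, the number of those in `S` that reach `z` is binomial and
independent of the remaining coordinate `l`. -/
lemma integral_mul_card_filter_lt {ι : Type*} [Fintype ι] [DecidableEq ι]
    {μ : Measure ℝ} [IsProbabilityMeasure μ] {S : Finset ι}
    {l : ι} (hl : l ∉ S) {ψ : ℝ → ℝ} (hψ : Integrable ψ μ) (k : ℕ) (z : ℝ) :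
    ∫ s, ψ (s l) * (if (S.filter (fun j => z ≤ s j)).card < k then 1 else 0)
        ∂(Measure.pi fun _ : ι => μ) =
      (∫ t, ψ t ∂μ) * binomialTail S.card k (μ.real (Ici z)) := by
  rw [integral_mul_apply_card_filter hl hψ (fun a => if a < k then 1 else 0)]
  congr 1
  rw [binomialTail]
  simp only [bernstein_eval, ite_mul, one_mul, zero_mul, mul_ite, mul_zero]
  rw [← Finset.sum_filter]
  simp only [mul_assoc]
  refine Finset.sum_subset (fun a ha => ?_) fun a ha ha' => ?_
  · exact Finset.mem_range.2 (Finset.mem_filter.1 ha).2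
  · have : S.card < a := by
      by_contra hcon
      exact ha' (Finset.mem_filter.2 ⟨Finset.mem_range.2 (by omega), Finset.mem_range.1 ha⟩)
    simp [Nat.choose_eq_zero_of_lt this]

lemma measurable_card_filter_le {ι : Type*} (S : Finset ι) (z : ℝ) :
    Measurable fun s : ι → ℝ => (S.filter (fun j => z ≤ s j)).card := by
  simp only [Finset.card_filter]
  refine Finset.measurable_sum _ fun j _ => ?_
  exact Measurable.ite (measurableSet_le measurable_const (measurable_pi_apply j))
    measurable_const measurable_const

lemma integrable_mul_card_filter_lt {ι : Type*} [Fintype ι]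
    {μ : Measure ℝ} [IsProbabilityMeasure μ] (S : Finset ι)
    {g : (ι → ℝ) → ℝ} (hg : Integrable g (Measure.pi fun _ : ι => μ)) (k : ℕ) (z : ℝ) :
    Integrable (fun s : ι → ℝ => g s * (if (S.filter (fun j => z ≤ s j)).card < k then 1 else 0))
      (Measure.pi fun _ : ι => μ) := by
  refine hg.mul_bdd (c := 1) ?_ (.of_forall fun s => ?_)
  · exact (Measurable.ite (measurableSet_lt (measurable_card_filter_le S z) measurable_const)
      measurable_const measurable_const).aestronglyMeasurable
  · split_ifs <;> simp

/-! ### The law of the pivotal signal -/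

/-- The regularity of the density `f`, set to zero off `(0, sbar)`, on which the analysis of the
auction rests. -/
structure IsPolyaDensity (h : ℝ → ℝ) (sbar : EReal) : Prop where
  polya : IsPolyaTwo h
  nonneg : ∀ t, 0 ≤ h t
  integrable : Integrable h
  integrable_mul : Integrable fun t => t * h t
  integral_eq_one : ∫ t, h t = 1
  pos : ∀ t ∈ openSupport sbar, 0 < h t
  eq_zero : ∀ t ∉ openSupport sbar, h t = 0
  continuousAt : ∀ t ∈ openSupport sbar, ContinuousAt h t

/-- The distribution function of the density `h`. -/
def lowerMass (h : ℝ → ℝ) (z : ℝ) : ℝ := ∫ t in Iic z, h t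

/-- The partial expectation of signals up to `z` under the density `h`. -/
def lowerMean (h : ℝ → ℝ) (z : ℝ) : ℝ := ∫ t in Iic z, t * h t

/-- The probability that at most `K + 1` of `m + K + 2` opponents have signals above `z`: the
chance of winning one of `K + 2` items when bidding as type `z`, among `m + K + 3` bidders.
Equivalently, the distribution function at `z` of the `(K + 2)`-th highest opposing signal. -/
def winProb (m K : ℕ) (h : ℝ → ℝ) (z : ℝ) : ℝ :=
  binomialTail (m + K + 2) (K + 2) (1 - lowerMass h z)

/-- The density of the `(K + 2)`-th highest of `m + K + 2` independent signals. -/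
def winDensity (m K : ℕ) (h : ℝ → ℝ) (z : ℝ) : ℝ :=
  ((m + K + 2 : ℕ) : ℝ) * (bernsteinPolynomial ℝ (m + K + 1) (K + 1)).eval (1 - lowerMass h z) * h z

/-- The expected sum of the opponents' signals on the event of winning as type `z`: by symmetry
`m + K + 2` times the contribution of one opponent, split according to whether that opponent's
signal is below or above `z`. -/
def othersMean (m K : ℕ) (h : ℝ → ℝ) (z : ℝ) : ℝ :=
  ((m + K + 2 : ℕ) : ℝ) * (lowerMean h z * binomialTail (m + K + 1) (K + 2) (1 - lowerMass h z) +
    ((∫ t, t * h t) - lowerMean h z) * binomialTail (m + K + 1) (K + 1) (1 - lowerMass h z))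

/-- The expected sum of the opponents' signals given that the `(K + 2)`-th highest of them equals
`z`: the pivotal signal `z` itself, `m` signals below it and `K + 1` above it. -/
def pivotalSum (m K : ℕ) (h : ℝ → ℝ) (z : ℝ) : ℝ :=
  z + m * (lowerMean h z / lowerMass h z) +
    ((K + 1 : ℕ) : ℝ) * (((∫ t, t * h t) - lowerMean h z) / (1 - lowerMass h z))

namespace IsPolyaDensity

variable {h : ℝ → ℝ} {sbar : EReal}

lemma one_sub_lowerMass (hh : IsPolyaDensity h sbar) (z : ℝ) :
    1 - lowerMass h z = ∫ t in Ioi z, h t := by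
  rw [lowerMass, ← hh.integral_eq_one,
    ← intervalIntegral.integral_Iic_add_Ioi hh.integrable.integrableOn
      hh.integrable.integrableOn (b := z)]
  ring

lemma mean_sub_lowerMean (hh : IsPolyaDensity h sbar) (z : ℝ) :
    (∫ t, t * h t) - lowerMean h z = ∫ t in Ioi z, t * h t := by
  rw [lowerMean, ← intervalIntegral.integral_Iic_add_Ioi hh.integrable_mul.integrableOn
    hh.integrable_mul.integrableOn (b := z)]
  ring

lemma setIntegral_pos (hh : IsPolyaDensity h sbar) {A : Set ℝ} {a b : ℝ} (hab : a < b)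
    (hA : Ioo a b ⊆ A) (hS : Ioo a b ⊆ openSupport sbar) : 0 < ∫ t in A, h t := by
  rw [setIntegral_pos_iff_support_of_nonneg_ae (.of_forall hh.nonneg) hh.integrable.integrableOn]
  have hsub : Ioo a b ⊆ Function.support h ∩ A := fun t ht => ⟨(hh.pos t (hS ht)).ne', hA ht⟩
  refine lt_of_lt_of_le ?_ (measure_mono hsub)
  rw [Real.volume_Ioo]
  exact ENNReal.ofReal_pos.2 (by linarith)

lemma lowerMass_pos (hh : IsPolyaDensity h sbar) {z : ℝ} (hz : z ∈ openSupport sbar) :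
    0 < lowerMass h z :=
  hh.setIntegral_pos hz.1 (fun _ ht => ht.2.le) fun t ht =>
    ⟨ht.1, lt_trans (by exact_mod_cast ht.2) hz.2⟩

lemma lowerMass_lt_one (hh : IsPolyaDensity h sbar) {z : ℝ} (hz : z ∈ openSupport sbar) :
    lowerMass h z < 1 := by
  obtain ⟨w, hzw, hw⟩ := EReal.lt_iff_exists_real_btwn.1 hz.2
  have hzw' : z < w := by exact_mod_cast hzw
  have := hh.setIntegral_pos (A := Ioi z) hzw' (fun _ ht => ht.1) fun t ht =>
    ⟨hz.1.trans ht.1, lt_trans (by exact_mod_cast ht.2) hw⟩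
  rw [← hh.one_sub_lowerMass] at this
  linarith

lemma lowerMass_mono (hh : IsPolyaDensity h sbar) : Monotone (lowerMass h) := fun _ _ hxy =>
  setIntegral_mono_set hh.integrable.integrableOn (.of_forall hh.nonneg)
    (.of_forall (Iic_subset_Iic.2 hxy))

lemma hasDerivAt_lowerMass (hh : IsPolyaDensity h sbar) {z : ℝ} (hz : z ∈ openSupport sbar) :
    HasDerivAt (lowerMass h) (h z) z :=
  hasDerivAt_integral_Iic hh.integrable (hh.continuousAt z hz)

lemma hasDerivAt_lowerMean (hh : IsPolyaDensity h sbar) {z : ℝ} (hz : z ∈ openSupport sbar) :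
    HasDerivAt (lowerMean h) (z * h z) z :=
  hasDerivAt_integral_Iic hh.integrable_mul (continuousAt_id.mul (hh.continuousAt z hz))

lemma hasDerivAt_binomialTail_lowerMass (hh : IsPolyaDensity h sbar) (N k : ℕ) {z : ℝ}
    (hz : z ∈ openSupport sbar) :
    HasDerivAt (fun z => binomialTail N (k + 1) (1 - lowerMass h z))
      (N * (bernsteinPolynomial ℝ (N - 1) k).eval (1 - lowerMass h z) * h z) z := by
  have h1 := HasDerivAt.comp z (h := fun z => 1 - lowerMass h z)
    (hasDerivAt_binomialTail N k (1 - lowerMass h z)) ((hh.hasDerivAt_lowerMass hz).const_sub 1)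
  exact h1.congr_deriv (by ring)

lemma hasDerivAt_winProb (hh : IsPolyaDensity h sbar) (m K : ℕ) {z : ℝ}
    (hz : z ∈ openSupport sbar) : HasDerivAt (winProb m K h) (winDensity m K h z) z :=
  hh.hasDerivAt_binomialTail_lowerMass (m + K + 2) (K + 1) hz

lemma winProb_pos (hh : IsPolyaDensity h sbar) (m K : ℕ) {z : ℝ}
    (hz : z ∈ openSupport sbar) : 0 < winProb m K h z :=
  binomialTail_pos (by linarith [hh.lowerMass_lt_one hz]) (by linarith [hh.lowerMass_pos hz])

lemma bernstein_pos (hh : IsPolyaDensity h sbar) (m K : ℕ) {z : ℝ} (hz : z ∈ openSupport sbar) :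
    0 < (bernsteinPolynomial ℝ (m + K + 1) (K + 1)).eval (1 - lowerMass h z) := by
  have h1 : 0 < 1 - lowerMass h z := by linarith [hh.lowerMass_lt_one hz]
  have h2 := hh.lowerMass_pos hz
  have h3 : 0 < (m + K + 1).choose (K + 1) := Nat.choose_pos (by omega)
  rw [bernstein_eval, sub_sub_cancel]
  positivity

lemma winDensity_pos (hh : IsPolyaDensity h sbar) (m K : ℕ) {z : ℝ}
    (hz : z ∈ openSupport sbar) : 0 < winDensity m K h z := by
  have h1 := hh.bernstein_pos m K hz
  have h2 := hh.pos z hz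
  unfold winDensity
  positivity

/-- The winning probability is log-concave: its logarithmic derivative is the product of the
reversed hazard rate of the signals and the elasticity of a binomial tail, both decreasing. -/
lemma winDensity_mul_winProb_le (hh : IsPolyaDensity h sbar) (m K : ℕ) {x y : ℝ}
    (hx : x ∈ openSupport sbar) (hy : y ∈ openSupport sbar) (hxy : x ≤ y) :
    winDensity m K h y * winProb m K h x ≤ winDensity m K h x * winProb m K h y := by
  have hpx := hh.lowerMass_pos hx
  have hpy := hh.lowerMass_pos hy
  have h1 : h y * lowerMass h x ≤ h x * lowerMass h y :=
    hh.polya.mul_integral_Iic_le hh.integrable hxy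
  have h2 := mul_bernstein_mul_binomialTail_le m K hpx (hh.lowerMass_mono hxy)
    (hh.lowerMass_lt_one hy)
  have h3 := mul_le_mul h1 h2 (mul_nonneg (mul_nonneg hpy.le (hh.bernstein_pos m K hy).le)
    (hh.winProb_pos m K hx).le) (mul_nonneg (hh.nonneg _) hpy.le)
  refine le_of_mul_le_mul_left ?_ (mul_pos hpx hpy)
  have h4 := mul_le_mul_of_nonneg_left h3 (Nat.cast_nonneg (α := ℝ) (m + K + 2))
  unfold winDensity winProb
  linarith

lemma tendsto_winProb (hh : IsPolyaDensity h sbar) (m K : ℕ) :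
    Tendsto (winProb m K h) (𝓝[>] 0) (𝓝 0) := by
  have h0 : lowerMass h 0 = 0 :=
    setIntegral_eq_zero_of_forall_eq_zero fun t ht =>
      hh.eq_zero t fun hS => absurd hS.1 (not_lt.2 ht)
  have hc : Continuous (winProb m K h) := by
    have h1 : Continuous (lowerMass h) := continuous_integral_Iic hh.integrable
    have h2 : Continuous (binomialTail (m + K + 2) (K + 2)) :=
      continuous_finsetSum _ fun a _ => Polynomial.continuous _
    exact h2.comp (continuous_const.sub h1)
  have h2 : winProb m K h 0 = 0 := by
    rw [winProb, h0, sub_zero]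
    exact binomialTail_one (by omega)
  have := hc.tendsto 0
  rw [h2] at this
  exact this.mono_left nhdsWithin_le_nhds

lemma hasDerivAt_othersMean (hh : IsPolyaDensity h sbar) (m K : ℕ) {z : ℝ}
    (hz : z ∈ openSupport sbar) :
    HasDerivAt (othersMean m K h) (winDensity m K h z * pivotalSum m K h z) z := by
  have hp := (hh.lowerMass_pos hz).ne'
  have hq : 1 - lowerMass h z ≠ 0 := by linarith [hh.lowerMass_lt_one hz] |> ne_of_gt
  have hM := hh.hasDerivAt_lowerMean hz
  have hT1 := hh.hasDerivAt_binomialTail_lowerMass (m + K + 1) (K + 1) hz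
  have hT2 := hh.hasDerivAt_binomialTail_lowerMass (m + K + 1) K hz
  have hD : HasDerivAt (othersMean m K h) _ z :=
    ((hM.mul hT1).add ((hM.const_sub (∫ t, t * h t)).mul hT2)).const_mul ((m + K + 2 : ℕ) : ℝ)
  refine hD.congr_deriv ?_
  have e1 := bernstein_eval_mul_one_sub m K (1 - lowerMass h z)
  have e2 := bernstein_eval_mul m K (1 - lowerMass h z)
  have e3 := binomialTail_succ (m + K + 1) (K + 1) (1 - lowerMass h z)
  rw [sub_sub_cancel, ← eq_div_iff hp] at e1
  rw [← eq_div_iff hq] at e2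
  simp only [Nat.add_sub_cancel]
  rw [e1, e2, e3]
  unfold winDensity pivotalSum
  ring

/-- The conditional expectation of a signal below `z` has derivative at most one, with
denominators cleared. -/
lemma mul_mul_lowerMass_sub_le (hh : IsPolyaDensity h sbar) (z : ℝ) :
    h z * (z * lowerMass h z - lowerMean h z) ≤ lowerMass h z ^ 2 := by
  have := hh.polya.mul_integral_sub_le_sq hh.nonneg hh.integrable hh.integrable_mul z
  simp only [sub_mul] at this
  rwa [integral_sub (hh.integrable.integrableOn.const_mul z) hh.integrable_mul.integrableOn,
    integral_const_mul] at this

/-- The conditional expectation of a signal above `z` has derivative at most one, with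
denominators cleared. -/
lemma mul_mean_sub_le (hh : IsPolyaDensity h sbar) (z : ℝ) :
    h z * ((∫ t, t * h t) - lowerMean h z - z * (1 - lowerMass h z)) ≤ (1 - lowerMass h z) ^ 2 := by
  have := hh.polya.mul_integral_sub_le_sq' hh.nonneg hh.integrable hh.integrable_mul z
  simp only [sub_mul] at this
  rwa [integral_sub hh.integrable_mul.integrableOn (hh.integrable.integrableOn.const_mul z),
    integral_const_mul, ← hh.one_sub_lowerMass, ← hh.mean_sub_lowerMean] at this

/-- Each of the `m + K + 2` conditional expectations in `pivotalSum` grows at rate at most one. -/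
lemma pivotalSum_sub_le (hh : IsPolyaDensity h sbar) (m K : ℕ) {x y : ℝ}
    (hx : x ∈ openSupport sbar) (hy : y ∈ openSupport sbar) (hyx : y ≤ x) :
    pivotalSum m K h x - pivotalSum m K h y ≤ ((m + K + 2 : ℕ) : ℝ) * (x - y) := by
  have hsub : ∀ z ∈ Icc y x, z ∈ openSupport sbar := fun z hz =>
    (openSupport_ordConnected sbar).out hy hx hz
  have hd : ∀ z ∈ openSupport sbar, ∃ d ≤ ((m + K + 2 : ℕ) : ℝ),
      HasDerivAt (pivotalSum m K h) d z := by
    intro z hz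
    have hp := hh.lowerMass_pos hz
    have hq : 0 < 1 - lowerMass h z := by linarith [hh.lowerMass_lt_one hz]
    have hP := hh.hasDerivAt_lowerMass hz
    have hM := hh.hasDerivAt_lowerMean hz
    have hD : HasDerivAt (pivotalSum m K h) _ z :=
      ((hasDerivAt_id z).add ((hM.div hP hp.ne').const_mul (m : ℝ))).add
        (((hM.const_sub (∫ t, t * h t)).div (hP.const_sub 1) hq.ne').const_mul ((K + 1 : ℕ) : ℝ))
    refine ⟨_, ?_, hD⟩
    have h1 : (z * h z * lowerMass h z - lowerMean h z * h z) / lowerMass h z ^ 2 ≤ 1 := by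
      rw [div_le_one (by positivity)]
      linarith [hh.mul_mul_lowerMass_sub_le z]
    have h2 : (-(z * h z) * (1 - lowerMass h z) - ((∫ t, t * h t) - lowerMean h z) * -h z) /
        (1 - lowerMass h z) ^ 2 ≤ 1 := by
      rw [div_le_one (by positivity)]
      linarith [hh.mul_mean_sub_le z]
    have h3 := mul_le_mul_of_nonneg_left h1 (Nat.cast_nonneg (α := ℝ) m)
    have h4 := mul_le_mul_of_nonneg_left h2 (Nat.cast_nonneg (α := ℝ) (K + 1))
    push_cast at h3 h4 ⊢
    linarith
  choose! d hd1 hd2 using hd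
  refine (convex_Icc y x).image_sub_le_mul_sub_of_deriv_le
    (fun z hz => (hd2 z (hsub z hz)).continuousAt.continuousWithinAt)
    (fun z hz => (hd2 z (hsub z (interior_subset hz))).differentiableAt.differentiableWithinAt)
    (fun z hz => ?_) y ⟨le_rfl, hyx⟩ x ⟨hyx, le_rfl⟩ hyx
  rw [(hd2 z (hsub z (interior_subset hz))).deriv]
  exact hd1 z (hsub z (interior_subset hz))

end IsPolyaDensity

/-! ### Signal profiles and the winning event -/

namespace IsSignalDensity

variable {f : ℝ → ℝ} {sbar : EReal}

lemma isProbabilityMeasure (hf : IsSignalDensity f sbar) : IsProbabilityMeasure (signalLaw f) :=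
  ⟨by rw [signalLaw, withDensity_apply _ MeasurableSet.univ, Measure.restrict_univ,
    hf.lintegral_eq_one]⟩

lemma ae_eq_indicator (hf : IsSignalDensity f sbar) :
    f =ᵐ[volume] (openSupport sbar).indicator f := by
  filter_upwards [hf.ae_eq_zero] with s hs
  by_cases h : s ∈ openSupport sbar
  · rw [indicator_of_mem h]
  · rw [indicator_of_notMem h, hs h]

lemma signalLaw_eq (hf : IsSignalDensity f sbar) :
    signalLaw f =
      volume.withDensity fun t => ENNReal.ofReal ((openSupport sbar).indicator f t) := by
  refine withDensity_congr_ae ?_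
  filter_upwards [hf.ae_eq_indicator] with s hs
  rw [← hs]

lemma indicator_nonneg (hf : IsSignalDensity f sbar) (t : ℝ) :
    0 ≤ (openSupport sbar).indicator f t :=
  Set.indicator_nonneg (fun s hs => (hf.pos s hs).le) t

lemma measurable_indicator (hf : IsSignalDensity f sbar) :
    Measurable ((openSupport sbar).indicator f) :=
  hf.measurable.indicator (isOpen_openSupport sbar).measurableSet

lemma integral_signalLaw (hf : IsSignalDensity f sbar) (φ : ℝ → ℝ) :
    ∫ t, φ t ∂(signalLaw f) = ∫ t, φ t * (openSupport sbar).indicator f t := by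
  rw [hf.signalLaw_eq, integral_withDensity_eq_integral_toReal_smul
    hf.measurable_indicator.ennreal_ofReal (by simp)]
  refine integral_congr_ae (.of_forall fun t => ?_)
  simp only [ENNReal.toReal_ofReal (hf.indicator_nonneg t), smul_eq_mul, mul_comm]

lemma integrable_signalLaw_iff (hf : IsSignalDensity f sbar) (φ : ℝ → ℝ) :
    Integrable φ (signalLaw f) ↔ Integrable fun t => φ t * (openSupport sbar).indicator f t := by
  rw [hf.signalLaw_eq, integrable_withDensity_iff_integrable_smul'
    hf.measurable_indicator.ennreal_ofReal (by simp)]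
  refine integrable_congr (.of_forall fun t => ?_)
  simp only [ENNReal.toReal_ofReal (hf.indicator_nonneg t), smul_eq_mul, mul_comm]

lemma ae_mem (hf : IsSignalDensity f sbar) : ∀ᵐ s ∂(signalLaw f), s ∈ openSupport sbar := by
  rw [signalLaw, ae_withDensity_iff hf.measurable.ennreal_ofReal]
  filter_upwards [hf.ae_eq_zero] with s hs hne
  by_contra hcon
  exact hne (by rw [hs hcon, ENNReal.ofReal_zero])

lemma integrable_id (hf : IsSignalDensity f sbar) : Integrable (fun t => t) (signalLaw f) := by
  have := hf.isProbabilityMeasure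
  refine Integrable.mono' ((integrable_const (1 : ℝ)).add hf.second_moment)
    measurable_id.aestronglyMeasurable (.of_forall fun t => ?_)
  rw [Real.norm_eq_abs]
  simp only [Pi.add_apply]
  nlinarith [sq_abs t, sq_nonneg (|t| - 1)]

lemma isPolyaDensity (hf : IsSignalDensity f sbar) (hlc : LogConcaveOn (openSupport sbar) f) :
    IsPolyaDensity ((openSupport sbar).indicator f) sbar where
  polya := hlc.isPolyaTwo (openSupport_ordConnected sbar) hf.pos
  nonneg := hf.indicator_nonneg
  integrable := by
    have := hf.isProbabilityMeasure
    simpa using (hf.integrable_signalLaw_iff (fun _ => 1)).1 (integrable_const _)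
  integrable_mul := (hf.integrable_signalLaw_iff _).1 hf.integrable_id
  integral_eq_one := by
    have := hf.isProbabilityMeasure
    have h := hf.integral_signalLaw (fun _ => 1)
    simpa using h.symm
  pos t ht := by rw [indicator_of_mem ht]; exact hf.pos t ht
  eq_zero t ht := indicator_of_notMem ht _
  continuousAt t ht := by
    have hn := (isOpen_openSupport sbar).mem_nhds ht
    refine ((hlc.continuousOn (isOpen_openSupport sbar) hf.pos).continuousAt hn).congr ?_
    filter_upwards [hn] with s hs
    rw [indicator_of_mem hs]

lemma integral_indicator_Iio (hf : IsSignalDensity f sbar) (φ : ℝ → ℝ) (z : ℝ) :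
    ∫ t, (Iio z).indicator φ t ∂(signalLaw f) =
      ∫ t in Iic z, φ t * (openSupport sbar).indicator f t := by
  rw [hf.integral_signalLaw, integral_Iic_eq_integral_Iio, ← integral_indicator measurableSet_Iio]
  refine integral_congr_ae (.of_forall fun t => ?_)
  simp only [← indicator_mul_left]

lemma measureReal_Ici (hf : IsSignalDensity f sbar) (z : ℝ) :
    (signalLaw f).real (Ici z) = 1 - lowerMass ((openSupport sbar).indicator f) z := by
  have := hf.isProbabilityMeasure
  have h := hf.integral_indicator_Iio 1 z
  rw [integral_indicator_one measurableSet_Iio] at h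
  rw [← compl_Iio, probReal_compl_eq_one_sub measurableSet_Iio, h, lowerMass]
  simp

lemma integral_indicator_Ici (hf : IsSignalDensity f sbar) (z : ℝ) :
    ∫ t, (Ici z).indicator (fun t => t) t ∂(signalLaw f) =
      (∫ t, t * (openSupport sbar).indicator f t) -
        lowerMean ((openSupport sbar).indicator f) z := by
  rw [lowerMean, ← hf.integral_indicator_Iio, ← hf.integral_signalLaw (fun t => t),
    ← integral_sub hf.integrable_id (hf.integrable_id.indicator measurableSet_Iio)]
  refine integral_congr_ae (.of_forall fun t => ?_)
  by_cases h : z ≤ t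
  · simp [h]
  · simp [h, not_le.1 h]

lemma ae_profile_mem (hf : IsSignalDensity f sbar) (n : ℕ) :
    ∀ᵐ s ∂(profileLaw n f), ∀ j, s j ∈ openSupport sbar := by
  have := hf.isProbabilityMeasure
  rw [ae_all_iff]
  exact fun j => (Measure.quasiMeasurePreserving_eval (fun _ : Fin n => signalLaw f) j).ae hf.ae_mem

/-- Ties have probability zero. -/
lemma ae_profile_injective (hf : IsSignalDensity f sbar) (n : ℕ) :
    ∀ᵐ s ∂(profileLaw n f), Function.Injective s := by
  have := hf.isProbabilityMeasure
  have hnull : NullSingletonClass (signalLaw f) := by unfold signalLaw; infer_instance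
  have hij : ∀ i j : Fin n, i ≠ j → ∀ᵐ s ∂(profileLaw n f), s i ≠ s j := by
    intro i j hij
    have hind : ProbabilityTheory.IndepFun (fun s : Fin n → ℝ => s i) (fun s => s j)
        (profileLaw n f) :=
      (ProbabilityTheory.iIndepFun_pi (X := fun _ : Fin n => (id : ℝ → ℝ))
        (fun _ => aemeasurable_id)).indepFun hij
    have hm : ∀ l : Fin n, (profileLaw n f).map (fun s => s l) = signalLaw f := fun l =>
      (measurePreserving_eval (fun _ : Fin n => signalLaw f) l).map_eq
    have : IsProbabilityMeasure (profileLaw n f) := by unfold profileLaw; infer_instance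
    have hmap := (ProbabilityTheory.indepFun_iff_map_prod_eq_prod_map_map
      (measurable_pi_apply i).aemeasurable (measurable_pi_apply j).aemeasurable).1 hind
    rw [hm, hm] at hmap
    have hdiag : ((signalLaw f).prod (signalLaw f)) {p : ℝ × ℝ | p.1 = p.2} = 0 := by
      rw [Measure.measure_prod_null (measurableSet_eq_fun measurable_fst measurable_snd)]
      refine .of_forall fun x => ?_
      have : Prod.mk x ⁻¹' {p : ℝ × ℝ | p.1 = p.2} = {x} := by ext y; simp [eq_comm]
      change signalLaw f (Prod.mk x ⁻¹' {p : ℝ × ℝ | p.1 = p.2}) = 0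
      rw [this]
      simp
    rw [← hmap, Measure.map_apply ((measurable_pi_apply i).prodMk (measurable_pi_apply j))
      (measurableSet_eq_fun measurable_fst measurable_snd)] at hdiag
    exact measure_eq_zero_iff_ae_notMem.1 hdiag
  have hall : ∀ᵐ s ∂(profileLaw n f), ∀ i j : Fin n, i ≠ j → s i ≠ s j := by
    simp only [ae_all_iff]
    exact hij
  filter_upwards [hall] with s hs i j h
  by_contra hne
  exact hs i j hne h

end IsSignalDensity

/-- Raising a winning bid leaves the highest losing bid unchanged. -/
lemma kthHighest_update_of_wins {n k : ℕ} (hkn : k < n) (b : Fin n → ℝ) (i : Fin n) {u v : ℝ}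
    (huv : u ≤ v) (hw : Wins k (Function.update b i u) i) :
    kthHighest (k + 1) (Function.update b i v) = kthHighest (k + 1) (Function.update b i u) := by
  refine eq_of_forall_le_iff fun t => ?_
  rw [le_kthHighest_iff (by omega) hkn, le_kthHighest_iff (by omega) hkn]
  rw [wins_iff hkn] at hw
  simp only [Function.update_self] at hw
  rcases le_or_gt t u with htu | htu
  · have : ∀ j, t ≤ Function.update b i v j ↔ t ≤ Function.update b i u j := by
      intro j
      by_cases hj : j = i
      · subst hj; simp [htu, htu.trans huv]
      · simp [hj]
    simp only [this]
  · have h1 : (Finset.univ.filter fun j => t ≤ Function.update b i u j).card ≤ k :=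
      le_trans (Finset.card_le_card (Finset.monotone_filter_right _
        fun j _ hj => htu.le.trans hj)) hw
    have h2 : (Finset.univ.filter fun j => t ≤ Function.update b i v j).card ≤ k := by
      refine le_trans (Finset.card_le_card fun j hj => ?_) hw
      simp only [Finset.mem_filter, Finset.mem_univ, true_and] at hj ⊢
      by_cases hji : j = i
      · subst hji; simp
      · simp only [Function.update_of_ne hji] at hj ⊢
        exact htu.le.trans hj
    omega

lemma le_kthHighest_update_of_not_wins {n k : ℕ} (hkn : k < n) (b : Fin n → ℝ) (i : Fin n)
    {u v : ℝ} (huv : u ≤ v) (hw : ¬ Wins k (Function.update b i u) i) :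
    u ≤ kthHighest (k + 1) (Function.update b i v) := by
  rw [wins_iff hkn, not_le] at hw
  rw [le_kthHighest_iff (by omega) hkn]
  refine le_trans hw (Finset.card_le_card fun j hj => ?_)
  simp only [Finset.mem_filter, Finset.mem_univ, true_and, Function.update_self] at hj ⊢
  by_cases hji : j = i
  · subst hji; simpa using huv
  · simpa only [Function.update_of_ne hji] using hj

/-- A bidder who bids as type `z` wins exactly if fewer than `k` opponents have signals reaching
`z`. -/
lemma wins_update_iff {n k : ℕ} (hkn : k < n) {sbar : EReal} {β : ℝ → ℝ}
    (hβ : StrictMonoOn β (openSupport sbar)) {s : Fin n → ℝ} (hs : ∀ j, s j ∈ openSupport sbar)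
    {z : ℝ} (hz : z ∈ openSupport sbar) (i : Fin n) :
    Wins k (Function.update (fun j => β (s j)) i (β z)) i ↔
      ((Finset.univ.erase i).filter (fun j => z ≤ s j)).card < k := by
  rw [wins_iff hkn]
  have : (Finset.univ.filter fun j => Function.update (fun j => β (s j)) i (β z) i ≤
      Function.update (fun j => β (s j)) i (β z) j) =
      insert i ((Finset.univ.erase i).filter (fun j => z ≤ s j)) := by
    ext j
    by_cases hji : j = i
    · subst hji; simp
    · simp [hji, hβ.le_iff_le hz (hs j)]
  rw [this, Finset.card_insert_of_notMem (by simp)]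
  omega

lemma wins_comp_iff {n k : ℕ} (hkn : k < n) {sbar : EReal} {β : ℝ → ℝ}
    (hβ : StrictMonoOn β (openSupport sbar)) {s : Fin n → ℝ} (hs : ∀ j, s j ∈ openSupport sbar)
    (i : Fin n) : Wins k (fun j => β (s j)) i ↔ Wins k s i := by
  rw [wins_iff hkn, wins_iff hkn]
  simp only [hβ.le_iff_le (hs i) (hs _)]

/-! ### Winning probabilities and prices -/

/-- The indicator of the event that bidder `i` wins when bidding as type `z`, expressed in the
opponents' signals. -/
def winIndicator {n : ℕ} (k : ℕ) (i : Fin n) (z : ℝ) (s : Fin n → ℝ) : ℝ :=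
  if ((Finset.univ.erase i).filter (fun j => z ≤ s j)).card < k then 1 else 0

/-- The `(k + 1)`-th highest bid when bidder `i` bids as type `z` and the others follow `β`, on
the event that `i` wins, and zero elsewhere. -/
def winPrice {n : ℕ} (k : ℕ) (β : ℝ → ℝ) (i : Fin n) (z : ℝ) (s : Fin n → ℝ) : ℝ :=
  winIndicator k i z s * kthHighest (k + 1) (Function.update (fun j => β (s j)) i (β z))

lemma winIndicator_eq_ite {n k : ℕ} (hkn : k < n) {sbar : EReal} {β : ℝ → ℝ}
    (hβ : StrictMonoOn β (openSupport sbar)) {s : Fin n → ℝ} (hs : ∀ j, s j ∈ openSupport sbar)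
    {z : ℝ} (hz : z ∈ openSupport sbar) (i : Fin n)
    [Decidable (Wins k (Function.update (fun j => β (s j)) i (β z)) i)] :
    winIndicator k i z s =
      if Wins k (Function.update (fun j => β (s j)) i (β z)) i then 1 else 0 := by
  simp only [winIndicator, wins_update_iff hkn hβ hs hz]

variable {f : ℝ → ℝ} {sbar : EReal}

lemma integrable_winIndicator (hf : IsSignalDensity f sbar) {n : ℕ} (k : ℕ) (i : Fin n) (z : ℝ) :
    Integrable (winIndicator k i z) (profileLaw n f) := by
  have := hf.isProbabilityMeasure
  have h := integrable_mul_card_filter_lt (μ := signalLaw f)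
    (Finset.univ.erase i) (integrable_const (1 : ℝ)) k z
  simp only [one_mul] at h
  exact h

lemma integral_winIndicator (hf : IsSignalDensity f sbar) (m K : ℕ) (i : Fin (m + K + 3)) (z : ℝ) :
    ∫ s, winIndicator (K + 2) i z s ∂(profileLaw (m + K + 3) f) =
      winProb m K ((openSupport sbar).indicator f) z := by
  have := hf.isProbabilityMeasure
  have h := integral_mul_card_filter_lt (μ := signalLaw f) (Finset.notMem_erase i Finset.univ)
    (integrable_const (1 : ℝ)) (K + 2) z
  rw [hf.measureReal_Ici, Finset.card_erase_of_mem (Finset.mem_univ _), Finset.card_univ,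
    Fintype.card_fin] at h
  simpa [winIndicator, winProb, profileLaw] using h

lemma integrable_mul_winIndicator (hf : IsSignalDensity f sbar) {n : ℕ} (k : ℕ) (i j : Fin n)
    (z : ℝ) : Integrable (fun s => s j * winIndicator k i z s) (profileLaw n f) := by
  have := hf.isProbabilityMeasure
  exact integrable_mul_card_filter_lt _
    (integrable_comp_eval (μ := fun _ : Fin n => signalLaw f) (i := j) hf.integrable_id) k z

lemma integral_mul_winIndicator (hf : IsSignalDensity f sbar) (m K : ℕ) {i j : Fin (m + K + 3)}
    (hij : j ≠ i) (z : ℝ) :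
    ∫ s, s j * winIndicator (K + 2) i z s ∂(profileLaw (m + K + 3) f) =
      othersMean m K ((openSupport sbar).indicator f) z / ((m + K + 2 : ℕ) : ℝ) := by
  have := hf.isProbabilityMeasure
  set S := (Finset.univ.erase i).erase j with hS
  have hcard : S.card = m + K + 1 := by
    rw [hS, Finset.card_erase_of_mem (Finset.mem_erase.2 ⟨hij, Finset.mem_univ _⟩),
      Finset.card_erase_of_mem (Finset.mem_univ _), Finset.card_univ, Fintype.card_fin]
    omega
  have hjS : j ∉ S := Finset.notMem_erase _ _
  have hins : Finset.univ.erase i = insert j S :=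
    (Finset.insert_erase (Finset.mem_erase.2 ⟨hij, Finset.mem_univ _⟩)).symm
  have hlo := integral_mul_card_filter_lt (μ := signalLaw f) hjS
    (hf.integrable_id.indicator (measurableSet_Iio (a := z))) (K + 2) z
  have hhi := integral_mul_card_filter_lt (μ := signalLaw f) hjS
    (hf.integrable_id.indicator (measurableSet_Ici (a := z))) (K + 1) z
  have ilo := integrable_mul_card_filter_lt (μ := signalLaw f) S
    (integrable_comp_eval (μ := fun _ : Fin (m + K + 3) => signalLaw f) (i := j)
      (hf.integrable_id.indicator (measurableSet_Iio (a := z)))) (K + 2) z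
  have ihi := integrable_mul_card_filter_lt (μ := signalLaw f) S
    (integrable_comp_eval (μ := fun _ : Fin (m + K + 3) => signalLaw f) (i := j)
      (hf.integrable_id.indicator (measurableSet_Ici (a := z)))) (K + 1) z
  rw [hf.measureReal_Ici, hcard] at hlo hhi
  rw [hf.integral_indicator_Ici] at hhi
  rw [hf.integral_indicator_Iio (fun t => t)] at hlo
  -- whether `j` is above or below `z` decides how many of the remaining bidders may be above `z`
  have hsplit : ∀ s : Fin (m + K + 3) → ℝ, s j * winIndicator (K + 2) i z s =
      (Iio z).indicator (fun t => t) (s j) *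
        (if (S.filter (fun l => z ≤ s l)).card < K + 2 then 1 else 0) +
      (Ici z).indicator (fun t => t) (s j) *
        (if (S.filter (fun l => z ≤ s l)).card < K + 1 then 1 else 0) := by
    intro s
    simp only [winIndicator, hins, Finset.filter_insert]
    by_cases h : z ≤ s j
    · rw [if_pos h, Finset.card_insert_of_notMem (by simp [hjS])]
      simp [h]
    · rw [if_neg h]
      simp [h, not_le.1 h]
  simp only [hsplit]
  rw [profileLaw, integral_add ilo ihi, hlo, hhi, othersMean, lowerMean, mul_div_cancel_left₀]
  exact_mod_cast (by omega : m + K + 2 ≠ 0)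

lemma integral_sum_mul_winIndicator (hf : IsSignalDensity f sbar) (m K : ℕ) (i : Fin (m + K + 3))
    (z : ℝ) :
    ∫ s, ∑ j ∈ Finset.univ.erase i, s j * winIndicator (K + 2) i z s ∂(profileLaw (m + K + 3) f) =
      othersMean m K ((openSupport sbar).indicator f) z := by
  rw [integral_finsetSum _ fun j _ => integrable_mul_winIndicator hf _ i j z,
    Finset.sum_congr rfl fun j hj => integral_mul_winIndicator hf m K (Finset.ne_of_mem_erase hj) z,
    Finset.sum_const, Finset.card_erase_of_mem (Finset.mem_univ _), Finset.card_univ,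
    Fintype.card_fin, nsmul_eq_mul]
  have : ((m + K + 2 : ℕ) : ℝ) ≠ 0 := by exact_mod_cast (by omega : m + K + 2 ≠ 0)
  exact mul_div_cancel₀ _ this

section Bidding

variable {n k : ℕ} {β : ℝ → ℝ}

lemma winPrice_mem_Icc (hkn : k < n) (hβ : StrictMonoOn β (openSupport sbar))
    (hβ0 : ∀ s ∈ openSupport sbar, 0 ≤ β s) {s : Fin n → ℝ} (hs : ∀ j, s j ∈ openSupport sbar)
    {z : ℝ} (hz : z ∈ openSupport sbar) (i : Fin n) : winPrice k β i z s ∈ Icc 0 (β z) := by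
  classical
  rw [winPrice, winIndicator_eq_ite hkn hβ hs hz]
  split_ifs with hw
  · rw [one_mul]
    refine ⟨?_, ?_⟩
    · rw [le_kthHighest_iff (by omega) hkn, Finset.filter_true_of_mem]
      · simpa using hkn
      · intro j _
        by_cases hji : j = i
        · subst hji; simpa using hβ0 z hz
        · simpa [hji] using hβ0 _ (hs j)
    · have : _ < _ := hw
      rw [Function.update_self] at this
      exact this.le
  · rw [zero_mul]
    exact ⟨le_rfl, hβ0 z hz⟩

lemma aestronglyMeasurable_winPrice (hf : IsSignalDensity f sbar) (hkn : k < n)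
    (hβ : StrictMonoOn β (openSupport sbar)) (i : Fin n) (z : ℝ) :
    AEStronglyMeasurable (winPrice k β i z) (profileLaw n f) := by
  have := hf.isProbabilityMeasure
  have h1 : AEMeasurable β (signalLaw f) := by
    have h := aemeasurable_restrict_of_monotoneOn (μ := signalLaw f)
      (isOpen_openSupport sbar).measurableSet hβ.monotoneOn
    rwa [Measure.restrict_eq_self_of_ae_mem hf.ae_mem] at h
  have h2 : AEMeasurable (fun s : Fin n → ℝ => Function.update (fun j => β (s j)) i (β z))
      (profileLaw n f) := by
    rw [aemeasurable_pi_iff]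
    intro j
    by_cases hji : j = i
    · subst hji; simp
    · simp only [Function.update_of_ne hji]
      exact h1.comp_quasiMeasurePreserving
        (Measure.quasiMeasurePreserving_eval (fun _ : Fin n => signalLaw f) j)
  exact (integrable_winIndicator hf k i z).1.mul
    ((measurable_kthHighest (by omega) hkn).comp_aemeasurable h2).aestronglyMeasurable

lemma integrable_winPrice (hf : IsSignalDensity f sbar) (hkn : k < n)
    (hβ : StrictMonoOn β (openSupport sbar)) (hβ0 : ∀ s ∈ openSupport sbar, 0 ≤ β s)
    {z : ℝ} (hz : z ∈ openSupport sbar) (i : Fin n) :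
    Integrable (winPrice k β i z) (profileLaw n f) := by
  have := hf.isProbabilityMeasure
  have : IsProbabilityMeasure (profileLaw n f) := by unfold profileLaw; infer_instance
  refine Integrable.mono' (integrable_const (β z))
    (aestronglyMeasurable_winPrice hf hkn hβ i z) ?_
  filter_upwards [hf.ae_profile_mem n] with s hs
  have h := winPrice_mem_Icc hkn hβ hβ0 hs hz i
  rw [Real.norm_eq_abs, abs_of_nonneg h.1]
  exact h.2

/-- The additional wins from bidding as type `x` rather than as type `z` come at prices between
`β z` and `β x`; the stated inequality covers both orders of `x` and `z`. -/
lemma winPrice_sub_le (hkn : k < n) (hβ : StrictMonoOn β (openSupport sbar))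
    {s : Fin n → ℝ} (hs : ∀ j, s j ∈ openSupport sbar) {x z : ℝ} (hx : x ∈ openSupport sbar)
    (hz : z ∈ openSupport sbar) (i : Fin n) :
    winPrice k β i x s - winPrice k β i z s ≤
      β x * (winIndicator k i x s - winIndicator k i z s) := by
  classical
  set b : Fin n → ℝ := fun j => β (s j) with hb
  have hmono : ∀ y ∈ openSupport sbar, ∀ y' ∈ openSupport sbar, y ≤ y' →
      Wins k (Function.update b i (β y)) i → Wins k (Function.update b i (β y')) i := by
    intro y hy y' hy' hyy hw
    rw [hb, wins_update_iff hkn hβ hs hy] at hw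
    rw [hb, wins_update_iff hkn hβ hs hy']
    exact lt_of_le_of_lt (Finset.card_le_card (Finset.monotone_filter_right _
      fun j _ hj => hyy.trans hj)) hw
  simp only [winPrice, winIndicator_eq_ite hkn hβ hs hx, winIndicator_eq_ite hkn hβ hs hz]
  change (if Wins k (Function.update b i (β x)) i then 1 else 0) *
      kthHighest (k + 1) (Function.update b i (β x)) -
    (if Wins k (Function.update b i (β z)) i then 1 else 0) *
      kthHighest (k + 1) (Function.update b i (β z)) ≤
    β x * ((if Wins k (Function.update b i (β x)) i then 1 else 0) -
      (if Wins k (Function.update b i (β z)) i then 1 else 0))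
  by_cases hwx : Wins k (Function.update b i (β x)) i <;>
    by_cases hwz : Wins k (Function.update b i (β z)) i
  · have : kthHighest (k + 1) (Function.update b i (β x)) =
        kthHighest (k + 1) (Function.update b i (β z)) := by
      rcases le_total x z with h | h
      · exact (kthHighest_update_of_wins hkn b i (hβ.monotoneOn hx hz h) hwx).symm
      · exact kthHighest_update_of_wins hkn b i (hβ.monotoneOn hz hx h) hwz
    simp [hwx, hwz, this]
  · have : _ < _ := hwx
    rw [Function.update_self] at this
    simp only [hwx, hwz, if_true, if_false]
    linarith
  · have hxz : x ≤ z := by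
      by_contra hcon
      exact hwx (hmono z hz x hx (not_le.1 hcon).le hwz)
    have := le_kthHighest_update_of_not_wins hkn b i (hβ.monotoneOn hx hz hxz) hwx
    simp only [hwx, hwz, if_true, if_false]
    linarith
  · simp [hwx, hwz]

/-- The surplus of a bidder with signal `x` who bids as type `z`. -/
lemma surplus_update_eq (hkn : k < n) (hβ : StrictMonoOn β (openSupport sbar)) (c δ x : ℝ)
    {s : Fin n → ℝ} (hs : ∀ j, s j ∈ openSupport sbar) {z : ℝ} (hz : z ∈ openSupport sbar)
    (i : Fin n) :
    surplus c k δ (Function.update s i x) (Function.update (fun j => β (s j)) i (β z)) i =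
      ((1 - c + c / n) * x - δ * β z) * winIndicator k i z s +
        c / n * ∑ j ∈ Finset.univ.erase i, s j * winIndicator k i z s -
        (1 - δ) * winPrice k β i z s := by
  classical
  have hsum : ∑ j, Function.update s i x j = x + ∑ j ∈ Finset.univ.erase i, s j := by
    rw [← Finset.add_sum_erase _ _ (Finset.mem_univ i), Function.update_self]
    congr 1
    exact Finset.sum_congr rfl fun j hj => Function.update_of_ne (Finset.ne_of_mem_erase hj) _ _
  rw [← Finset.sum_mul, winPrice, winIndicator_eq_ite hkn hβ hs hz, surplus, payment, value, hsum,
    Function.update_self, Function.update_self]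
  by_cases hw : Wins k (Function.update (fun j => β (s j)) i (β z)) i
  · simp only [hw, if_true]; ring
  · simp [hw]

end Bidding

/-! ### The equilibrium bidding strategy -/

lemma interimUtility_eq (hf : IsSignalDensity f sbar) (m K : ℕ) {β : ℝ → ℝ}
    (hβ : StrictMonoOn β (openSupport sbar)) (hβ0 : ∀ s ∈ openSupport sbar, 0 ≤ β s)
    (c δ x : ℝ) {z : ℝ} (hz : z ∈ openSupport sbar) (i : Fin (m + K + 3)) :
    interimUtility (m + K + 3) f c (K + 2) δ β i x (β z) =
      ((1 - c + c / ((m + K + 3 : ℕ) : ℝ)) * x - δ * β z) *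
          winProb m K ((openSupport sbar).indicator f) z +
        c / ((m + K + 3 : ℕ) : ℝ) * othersMean m K ((openSupport sbar).indicator f) z -
        (1 - δ) * ∫ s, winPrice (K + 2) β i z s ∂(profileLaw (m + K + 3) f) := by
  have hkn : K + 2 < m + K + 3 := by omega
  have e : interimUtility (m + K + 3) f c (K + 2) δ β i x (β z) =
      ∫ s, (((1 - c + c / ((m + K + 3 : ℕ) : ℝ)) * x - δ * β z) * winIndicator (K + 2) i z s +
        c / ((m + K + 3 : ℕ) : ℝ) * ∑ j ∈ Finset.univ.erase i, s j * winIndicator (K + 2) i z s -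
        (1 - δ) * winPrice (K + 2) β i z s) ∂(profileLaw (m + K + 3) f) := by
    refine integral_congr_ae ?_
    filter_upwards [hf.ae_profile_mem (m + K + 3)] with s hs
    exact surplus_update_eq hkn hβ c δ x hs hz i
  have i1 := (integrable_winIndicator hf (K + 2) i z).const_mul
    ((1 - c + c / ((m + K + 3 : ℕ) : ℝ)) * x - δ * β z)
  have i2 := (integrable_finsetSum (Finset.univ.erase i) fun j _ =>
    integrable_mul_winIndicator hf (K + 2) i j z).const_mul (c / ((m + K + 3 : ℕ) : ℝ))
  have i3 := (integrable_winPrice hf hkn hβ hβ0 hz i).const_mul (1 - δ)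
  have i12 : Integrable (fun s =>
        ((1 - c + c / ((m + K + 3 : ℕ) : ℝ)) * x - δ * β z) * winIndicator (K + 2) i z s +
        c / ((m + K + 3 : ℕ) : ℝ) * ∑ j ∈ Finset.univ.erase i, s j * winIndicator (K + 2) i z s)
      (profileLaw (m + K + 3) f) := i1.add i2
  rw [e, integral_sub i12 i3, integral_add i1 i2, integral_const_mul, integral_const_mul,
    integral_const_mul, integral_winIndicator hf, integral_sum_mul_winIndicator hf]

/-- The expected value of an item to a bidder with signal `z` whose `(K + 2)`-th highest opposing
signal is also `z`, among `m + K + 3` bidders. -/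
def pivotalValue (m K : ℕ) (c : ℝ) (h : ℝ → ℝ) (z : ℝ) : ℝ :=
  (1 - c + c / ((m + K + 3 : ℕ) : ℝ)) * z + c / ((m + K + 3 : ℕ) : ℝ) * pivotalSum m K h z

/-- The weights of the own signal and of the `m + K + 2` opposing ones add up to one. -/
lemma IsPolyaDensity.pivotalValue_sub_le {h : ℝ → ℝ} (hh : IsPolyaDensity h sbar) (m K : ℕ)
    {c : ℝ} (hc : 0 ≤ c) {x y : ℝ}
    (hx : x ∈ openSupport sbar) (hy : y ∈ openSupport sbar) (hyx : y ≤ x) :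
    pivotalValue m K c h x - pivotalValue m K c h y ≤ x - y := by
  have hn : (0 : ℝ) < ((m + K + 3 : ℕ) : ℝ) := by positivity
  have h1 := mul_le_mul_of_nonneg_left (hh.pivotalSum_sub_le m K hx hy hyx) (div_nonneg hc hn.le)
  have h2 : c / ((m + K + 3 : ℕ) : ℝ) * (((m + K + 2 : ℕ) : ℝ) + 1) = c := by
    rw [div_mul_eq_mul_div, div_eq_iff hn.ne']
    push_cast; ring
  unfold pivotalValue
  linear_combination h1 + (x - y) * h2

/-- The first-order condition of the equilibrium. No regularity of `β` beyond monotonicity is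
assumed: incentive compatibility forces the expected payment, hence `β`, to be continuous and then
differentiable. -/
lemma hasDerivAt_equilibrium (hf : IsSignalDensity f sbar)
    (hlc : LogConcaveOn (openSupport sbar) f) (m K : ℕ) {c δ : ℝ} (hδ0 : 0 < δ) {β : ℝ → ℝ}
    (hβ : IsSymmetricEquilibrium (m + K + 3) f sbar c (K + 2) δ β) {x : ℝ}
    (hx : x ∈ openSupport sbar) :
    HasDerivAt β ((pivotalValue m K c ((openSupport sbar).indicator f) x - β x) *
      winDensity m K ((openSupport sbar).indicator f) x /
        (δ * winProb m K ((openSupport sbar).indicator f) x)) x := by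
  have hh := hf.isPolyaDensity hlc
  set h := (openSupport sbar).indicator f with hdef
  set G := winProb m K h with hG
  set S := othersMean m K h with hS
  set a : ℝ := 1 - c + c / ((m + K + 3 : ℕ) : ℝ) with ha
  set e : ℝ := c / ((m + K + 3 : ℕ) : ℝ) with he
  have hkn : K + 2 < m + K + 3 := by omega
  let i : Fin (m + K + 3) := ⟨0, by omega⟩
  set B : ℝ → ℝ := fun z => ∫ s, winPrice (K + 2) β i z s ∂(profileLaw (m + K + 3) f) with hB
  have hn := (isOpen_openSupport sbar).mem_nhds hx
  have hGd := hh.hasDerivAt_winProb m K hx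
  -- incentive compatibility bounds the increments of the expected payment, net of `e * S`
  have hIC : ∀ y ∈ openSupport sbar, ∀ z ∈ openSupport sbar,
      (δ * β y * G y + (1 - δ) * B y - e * S y) - (δ * β z * G z + (1 - δ) * B z - e * S z) ≤
        a * y * (G y - G z) := by
    intro y hy z hz
    have := hβ.optimal i y hy (β z) (hβ.nonneg z hz)
    rw [interimUtility_eq hf m K hβ.strictMonoOn hβ.nonneg c δ y hz i,
      interimUtility_eq hf m K hβ.strictMonoOn hβ.nonneg c δ y hy i] at this
    linarith
  -- the monotonicity of prices bounds the increments of the expected price in the same way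
  have hBle : ∀ y ∈ openSupport sbar, ∀ z ∈ openSupport sbar, B y - B z ≤ β y * (G y - G z) := by
    intro y hy z hz
    simp only [hB, hG]
    rw [← integral_winIndicator hf m K i y, ← integral_winIndicator hf m K i z,
      ← integral_sub (integrable_winPrice hf hkn hβ.strictMonoOn hβ.nonneg hy i)
        (integrable_winPrice hf hkn hβ.strictMonoOn hβ.nonneg hz i),
      ← integral_sub (integrable_winIndicator hf _ i y) (integrable_winIndicator hf _ i z),
      ← integral_const_mul]
    refine integral_mono_ae ((integrable_winPrice hf hkn hβ.strictMonoOn hβ.nonneg hy i).sub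
        (integrable_winPrice hf hkn hβ.strictMonoOn hβ.nonneg hz i))
      (((integrable_winIndicator hf _ i y).sub (integrable_winIndicator hf _ i z)).const_mul _) ?_
    filter_upwards [hf.ae_profile_mem (m + K + 3)] with s hs
    exact winPrice_sub_le hkn hβ.strictMonoOn hs hy hz i
  -- the expected payment, net of `e * S`, is differentiable,
  -- although `β` is not yet known to be continuous
  have hP : HasDerivAt (fun z => δ * β z * G z + (1 - δ) * B z - e * S z)
      (a * x * winDensity m K h x) x :=
    hasDerivAt_of_increment_le hn hIC (continuousAt_const.mul continuousAt_id) hGd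
  have hPS : HasDerivAt (fun z => δ * β z * G z + (1 - δ) * B z)
      (pivotalValue m K c h x * winDensity m K h x) x := by
    have h1 := hP.add ((hh.hasDerivAt_othersMean m K hx).const_mul e)
    refine (h1.congr_of_eventuallyEq (.of_forall fun z => ?_)).congr_deriv ?_
    · simp only [Pi.add_apply, hS]; ring
    · simp only [pivotalValue, ha, he]; ring
  have hBc : ContinuousAt B x := by
    obtain ⟨u, hxu, hu⟩ := EReal.lt_iff_exists_real_btwn.1 hx.2
    have hxu' : x < u := by exact_mod_cast hxu
    have huS : u ∈ openSupport sbar := ⟨hx.1.trans hxu', hu⟩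
    have hbound : ∀ y ∈ openSupport sbar ∩ Iio u, ‖B y - B x‖ ≤ β u * ‖G y - G x‖ := by
      intro y hy
      have a1 := hBle y hy.1 x hx
      have a2 := hBle x hx y hy.1
      have a3 : ∀ w ∈ openSupport sbar, w ≤ u → |β w * (G y - G x)| ≤ β u * |G y - G x| := by
        intro w hw hwu
        rw [abs_mul, abs_of_nonneg (hβ.nonneg w hw)]
        exact mul_le_mul_of_nonneg_right (hβ.strictMonoOn.monotoneOn hw huS hwu) (abs_nonneg _)
      have a4 := a3 y hy.1 (le_of_lt hy.2)
      have a5 := a3 x hx hxu'.le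
      rw [Real.norm_eq_abs, Real.norm_eq_abs, abs_le]
      constructor
      · linarith [neg_abs_le (β x * (G y - G x))]
      · linarith [le_abs_self (β y * (G y - G x))]
    have hlim : Tendsto (fun y => β u * ‖G y - G x‖) (𝓝 x) (𝓝 0) := by
      have := ((hGd.continuousAt.sub continuousAt_const).norm.const_mul (β u)
        : ContinuousAt (fun y => β u * ‖G y - G x‖) x).tendsto
      simpa using this
    rw [ContinuousAt, tendsto_iff_norm_sub_tendsto_zero]
    refine squeeze_zero' (.of_forall fun _ => norm_nonneg _) ?_ hlim
    filter_upwards [hn, Iio_mem_nhds hxu'] with y hy hy' using hbound y ⟨hy, hy'⟩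
  have hβeq : ∀ z ∈ openSupport sbar,
      β z = ((δ * β z * G z + (1 - δ) * B z) - (1 - δ) * B z) / (δ * G z) := by
    intro z hz
    have := (hh.winProb_pos m K hz).ne'
    rw [eq_div_iff (mul_ne_zero hδ0.ne' this)]
    ring
  have hGx := (hh.winProb_pos m K hx).ne'
  have hβev : β =ᶠ[𝓝 x] fun z =>
      ((δ * β z * G z + (1 - δ) * B z) - (1 - δ) * B z) / (δ * G z) := by
    filter_upwards [hn] with z hz using hβeq z hz
  have hβc : ContinuousAt β x :=
    ((hPS.continuousAt.sub (continuousAt_const.mul hBc)).div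
      (continuousAt_const.mul hGd.continuousAt) (mul_ne_zero hδ0.ne' hGx)).congr hβev.symm
  have hBd : HasDerivAt B (β x * winDensity m K h x) x :=
    hasDerivAt_of_increment_le hn hBle hβc hGd
  have hβd := ((hPS.sub (hBd.const_mul (1 - δ))).div (hGd.const_mul δ)
    (mul_ne_zero hδ0.ne' hGx)).congr_of_eventuallyEq hβev
  refine hβd.congr_deriv ?_
  simp only [Pi.sub_apply]
  rw [div_eq_div_iff (pow_ne_zero 2 (mul_ne_zero hδ0.ne' hGx)) (mul_ne_zero hδ0.ne' hGx)]
  ring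

/-- Equilibrium bids increase strictly more slowly than signals. -/
lemma equilibrium_sub_lt (hf : IsSignalDensity f sbar)
    (hlc : LogConcaveOn (openSupport sbar) f) {n k : ℕ} (hk : 2 ≤ k) (hkn : k < n) {c δ : ℝ}
    (hc : 0 ≤ c) (hδ0 : 0 < δ) {β : ℝ → ℝ} (hβ : IsSymmetricEquilibrium n f sbar c k δ β) {x y : ℝ}
    (hx : x ∈ openSupport sbar) (hy : y ∈ openSupport sbar) (hyx : y < x) :
    β x - β y < x - y := by
  obtain ⟨K, rfl⟩ := Nat.exists_eq_add_of_le' hk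
  obtain ⟨m, rfl⟩ : ∃ m, n = m + K + 3 := ⟨n - (K + 3), by omega⟩
  have hh := hf.isPolyaDensity hlc
  have hd := fun z (hz : z ∈ openSupport sbar) => hasDerivAt_equilibrium hf hlc m K hδ0 hβ hz
  have hlt := fun z (hz : z ∈ openSupport sbar) => bid_slope_lt_one hδ0
    (fun y hy => hh.winProb_pos m K hy) (fun y hy => hh.winDensity_pos m K hy)
    (fun y hy => hh.hasDerivAt_winProb m K hy)
    (fun x hx y hy hxy => hh.winDensity_mul_winProb_le m K hx hy hxy) (hh.tendsto_winProb m K)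
    (fun y hy x hx hyx => hh.pivotalValue_sub_le m K hc hx hy hyx) hβ.nonneg
    hβ.strictMonoOn.monotoneOn hd hz
  have hsub : ∀ z ∈ Icc y x, z ∈ openSupport sbar := fun z hz =>
    (openSupport_ordConnected sbar).out hy hx hz
  have := (convex_Icc y x).image_sub_lt_mul_sub_of_deriv_lt (C := 1)
    (fun z hz => (hd z (hsub z hz)).continuousAt.continuousWithinAt)
    (fun z hz => (hd z (hsub z (interior_subset hz))).differentiableAt.differentiableWithinAt)
    (fun z hz => by
      rw [(hd z (hsub z (interior_subset hz))).deriv]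
      exact hlt z (hsub z (interior_subset hz))) y ⟨le_rfl, hyx.le⟩ x ⟨hyx.le, le_rfl⟩ hyx
  linarith

/-! ### Utility differences between winners -/

lemma outcome_sub {n k : ℕ} (hkn : k < n) {β : ℝ → ℝ}
    (hβ : StrictMonoOn β (openSupport sbar)) (c δ : ℝ) {s : Fin n → ℝ}
    (hs : ∀ j, s j ∈ openSupport sbar) {i j : Fin n} (hi : Wins k s i) (hj : Wins k s j) :
    outcome c k δ β s i - outcome c k δ β s j =
      (1 - c) * (s i - s j) - δ * (β (s i) - β (s j)) := by
  have hi' := (wins_comp_iff hkn hβ hs i).2 hi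
  have hj' := (wins_comp_iff hkn hβ hs j).2 hj
  simp only [outcome, surplus, payment, hi', hj', if_true, value]
  ring

lemma abs_sub_lt_abs {a δ u w : ℝ} (hδ0 : 0 < δ) (hδ : δ ≤ 2 * a) (hw : 0 < w) (hwu : w < u) :
    |a * u - δ * w| < |a * u| := by
  have ha : 0 < a := by linarith
  have h1 : 0 < δ * w := mul_pos hδ0 hw
  have h2 : δ * w < 2 * a * u := by nlinarith
  rw [abs_of_pos (mul_pos ha (hw.trans hwu)), abs_lt]
  constructor <;> linarith

end MixedAuction

end

theorem mainTheorem4 (n k : ℕ) (hk : 2 ≤ k) (hkn : k < n)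
    (f : ℝ → ℝ) (sbar : EReal) (hf : MixedAuction.IsSignalDensity f sbar)
    (hlc : MixedAuction.LogConcaveOn (MixedAuction.openSupport sbar) f)
    (c : ℝ) (hc0 : 0 ≤ c) (hc1 : c ≤ 1)
    (δ : ℝ) (hδ0 : 0 < δ) (hδ : δ ≤ min 1 (2 * (1 - c)))
    (βδ βU : ℝ → ℝ)
    (hβδ : MixedAuction.IsSymmetricEquilibrium n f sbar c k δ βδ)
    (hβU : MixedAuction.IsSymmetricEquilibrium n f sbar c k 0 βU) :
    MixedAuction.DominatesInPairwiseDifferences (n := n) f k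
      (MixedAuction.outcome c k δ βδ) (MixedAuction.outcome c k 0 βU) := by
  have hδ2 : δ ≤ 2 * (1 - c) := hδ.trans (min_le_right _ _)
  filter_upwards [hf.ae_profile_mem n, hf.ae_profile_injective n] with s hs hinj
  have key : ∀ i j, s j < s i → MixedAuction.Wins k s i → MixedAuction.Wins k s j →
      |MixedAuction.outcome c k δ βδ s i - MixedAuction.outcome c k δ βδ s j| <
        |MixedAuction.outcome c k 0 βU s i - MixedAuction.outcome c k 0 βU s j| := by
    intro i j hij hi hj
    rw [MixedAuction.outcome_sub hkn hβδ.strictMonoOn c δ hs hi hj,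
      MixedAuction.outcome_sub hkn hβU.strictMonoOn c 0 hs hi hj, zero_mul, sub_zero]
    exact MixedAuction.abs_sub_lt_abs hδ0 hδ2
      (sub_pos.2 (hβδ.strictMonoOn (hs j) (hs i) hij))
      (MixedAuction.equilibrium_sub_lt hf hlc hk hkn hc0 hδ0 hβδ (hs i) (hs j) hij)
  have key' : ∀ i j, i ≠ j → MixedAuction.Wins k s i → MixedAuction.Wins k s j →
      |MixedAuction.outcome c k δ βδ s i - MixedAuction.outcome c k δ βδ s j| <
        |MixedAuction.outcome c k 0 βU s i - MixedAuction.outcome c k 0 βU s j| := by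
    intro i j hij hi hj
    rcases lt_or_gt_of_ne (hinj.ne hij) with h | h
    · have := key j i h hj hi
      rwa [abs_sub_comm, abs_sub_comm (MixedAuction.outcome c k 0 βU s j)] at this
    · exact key i j h hi hj
  refine ⟨fun i j hi hj => ?_, ?_⟩
  · rcases eq_or_ne i j with rfl | hij
    · simp
    · exact (key' i j hij hi hj).le
  · obtain ⟨i, j, hij, hi, hj⟩ := MixedAuction.exists_two_winners hk hkn hinj
    exact ⟨i, j, hi, hj, key' i j hij hi hj⟩
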